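/- **Setting.** Items with positive real weights $w_i$ arrive one at a time, and a reservoir of capacity $k\ge 1$ is maintained. Once it is full, it consists of a threshold $\tau\ge 0$, a set $L$ of large items ($w_i>\tau$, adjusted weight $\tilde w_i=w_i$) and a set $T$ of small items (adjusted weight $\tilde w_i=\tau$), with $|L|+|T|=k$. Initially $L=T=\emptyset$ and $\tau=0$. Both sets are stored in height-balanced (AVL) binary trees, $L$ sorted by weight and $T$ in arbitrary order; each node stores the number of items and the total weight of its subtree. Insertion, deletion, split, concatenation and search cost one step per recursive call. The smallest weight $w_\ell$ in $L$ is also stored ($w_\ell=\infty$ if $L=\emptyset$). A new item $j$ is processed as follows. *Filling.* If $|L|+|T|<k$, insert $j$ into $L$. *Fast path.* Otherwise let $\tau'=(w_j+|T|\tau)/|T|$. If $|T|=0$, $w_j\ge\tau'$ or $\tau'\ge w_\ell$, use the tree implementation below. Otherwise draw a uniformly random $r\in(0,1)$. If $\tau'-w_j\ge r\tau'$, skip item $j$ and set $\tau:=\tau'$; nothing else is done (this is the simple case). If not, use the tree implementation with this $r$ and with $j$ first in the order. *Tree implementation.* Order the $k+1$ items of $L\cup T\cup\{j\}$ as $\tilde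 w_{(1)},\dots,\tilde w_{(k+1)}$ by increasing adjusted weight (with $\tilde w_j=w_j$). In the case just mentioned, $j$ is instead placed first; in general $j$ comes first if $w_j\le\tau$, and is inserted into $L$ otherwise. Using binary search in the trees, find the largest $t$ with $\sum_{x\le t}\tilde w_{(x)}\ge (t-1)\tilde w_{(t)}$, set $\tau_{\rm new}=\sum_{x\le t}\tilde w_{(x)}/(t-1)$, and, for a uniformly random $r\in(0,1)$, find the smallest $d\le t$ with $d\,\tau_{\rm new}-\sum_{x\le d}\tilde w_{(x)}\ge r\,\tau_{\rm new}$. Drop the $d$-th item, move the remaining ones among the first $t$ items to $T$ (by splitting $L$ and concatenating), and set $\tau:=\tau_{\rm new}$. Time is counted on a real RAM: real arithmetic, comparisons, accessing or creating a tree node, and drawing a random number take constant time. The random numbers of different rounds are independent. **Theorem.** There is an absolute constant $C$ such that for all integers $k\ge1$ and $n\ge 1$ and all positive weights $w_1,\dots,w_n$, if the $n$ items arrive in a uniformly random order, independent of the random numbers of the algorithm, then the expected time (over the order and over the random numbers) of processing the whole stream is at most $$C\,\bigl(n+k(\log k)(\log n)\bigr).$$ -/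

import Mathlib

noncomputable section

namespace VarOpt

/-- A value together with the number of unit-cost steps spent on computing it (real RAM).
Every call of a recursive procedure and every call of one of the main procedures below is charged
one step; besides the charged calls, each of their bodies performs only a bounded number of
elementary operations: real and integer arithmetic, comparisons, reading or creating a tree node
and, in the main procedure, the generation of one random number. -/
structure Timed (α : Type) where
  val : α
  steps : ℕ

instance : Monad Timed where
  pure a := ⟨a, 0⟩
  bind x f := ⟨(f x.val).val, x.steps + (f x.val).steps⟩

/-- Spend one step. -/
def tick : Timed Unit := ⟨(), 1⟩

/-- A stream item, with its identity and its weight. -/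
structure Item where
  id : ℕ
  weight : ℝ

/-- Binary trees whose nodes cache the height, the number of items and the total weight of the
subtree that they root. -/
inductive Tree where
  | leaf : Tree
  | node (height size : ℕ) (total : ℝ) (left : Tree) (item : Item) (right : Tree) : Tree

namespace Tree

/-- The cached height (constant time). -/
def height : Tree → ℕ
  | leaf => 0
  | node h _ _ _ _ _ => h

/-- The cached number of items (constant time). -/
def size : Tree → ℕ
  | leaf => 0
  | node _ n _ _ _ _ => n

/-- The cached total weight (constant time). -/
def total : Tree → ℝ
  | leaf => 0
  | node _ _ s _ _ _ => s

/-- Create one node. -/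
def mk (l : Tree) (x : Item) (r : Tree) : Tree :=
  node (max l.height r.height + 1) (l.size + 1 + r.size) (l.total + x.weight + r.total) l x r

/-- Create a node and restore the AVL condition by a single or a double rotation where the heights
of the two subtrees differ by two. -/
def balance (l : Tree) (x : Item) (r : Tree) : Tree :=
  if r.height + 1 < l.height then
    match l with
    | leaf => mk l x r
    | node _ _ _ ll y lr =>
      if lr.height ≤ ll.height then mk ll y (mk lr x r)
      else
        match lr with
        | leaf => mk l x r
        | node _ _ _ a z b => mk (mk ll y a) z (mk b x r)
  else if l.height + 1 < r.height then
    match r with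
    | leaf => mk l x r
    | node _ _ _ rl y rr =>
      if rl.height ≤ rr.height then mk (mk l x rl) y rr
      else
        match rl with
        | leaf => mk l x r
        | node _ _ _ a z b => mk (mk l x a) z (mk b y rr)
  else mk l x r

/-- Attach `x` and `r` on the right of `l`: descend the right spine of `l` to a subtree that is at
most one higher than `r`. -/
def joinRight (l : Tree) (x : Item) (r : Tree) : Timed Tree := do
  tick
  match l with
  | leaf => pure (mk leaf x r)
  | node h n s ll y lr =>
    if h ≤ r.height + 1 then pure (mk (node h n s ll y lr) x r)
    else
      let lr' ← joinRight lr x r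
      pure (balance ll y lr')

/-- Attach `l` and `x` on the left of `r`: descend the left spine of `r` to a subtree that is at
most one higher than `l`. -/
def joinLeft (l : Tree) (x : Item) (r : Tree) : Timed Tree := do
  tick
  match r with
  | leaf => pure (mk l x leaf)
  | node h n s rl y rr =>
    if h ≤ l.height + 1 then pure (mk l x (node h n s rl y rr))
    else
      let rl' ← joinLeft l x rl
      pure (balance rl' y rr)

/-- The AVL tree of the items of `l`, then `x`, then the items of `r`. -/
def join (l : Tree) (x : Item) (r : Tree) : Timed Tree := do
  tick
  if r.height ≤ l.height then joinRight l x r else joinLeft l x r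

/-- The tree of the first `i` items and the tree of the others. -/
def splitAt (i : ℕ) (t : Tree) : Timed (Tree × Tree) := do
  tick
  match t with
  | leaf => pure (leaf, leaf)
  | node _ _ _ l x r =>
    if i ≤ l.size then
      let p ← splitAt i l
      let b ← join p.2 x r
      pure (p.1, b)
    else
      let p ← splitAt (i - (l.size + 1)) r
      let a ← join l x p.1
      pure (a, p.2)

/-- Remove the first item, if there is one. -/
def popFirst (t : Tree) : Timed (Option (Item × Tree)) := do
  tick
  match t with
  | leaf => pure none
  | node _ _ _ l x r =>
    let p ← popFirst l
    match p with
    | none => pure (some (x, r))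
    | some (y, l') =>
      let t' ← join l' x r
      pure (some (y, t'))

/-- The weight of the first item, if there is one. -/
def firstWeight (t : Tree) : Timed (Option ℝ) := do
  tick
  match t with
  | leaf => pure none
  | node _ _ _ l x _ =>
    let p ← firstWeight l
    pure (some (p.getD x.weight))

/-- Concatenation. -/
def concat (a b : Tree) : Timed Tree := do
  tick
  let p ← popFirst b
  match p with
  | none => pure a
  | some (x, b') => join a x b'

/-- Delete the item that has exactly `i` items before it. -/
def deleteAt (i : ℕ) (t : Tree) : Timed Tree := do
  tick
  let p ← splitAt i t
  let q ← popFirst p.2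
  match q with
  | none => pure p.1
  | some (_, b) => concat p.1 b

/-- Binary search along a path from the root. At a node whose item is, in the order of the whole
tree, the `c`-th one, with total weight `s` of the first `c` items and with own weight `v`, the
search goes on to the right if `goRight c s v` and to the left otherwise. The result is the number
and the total weight of all the items to the left of the place where the search ends. The arguments
`c₀` and `s₀` accumulate the number and weight of the items to the left of the current subtree. -/
def search (goRight : ℕ → ℝ → ℝ → Prop) [∀ c s v, Decidable (goRight c s v)]
    (t : Tree) (c₀ : ℕ) (s₀ : ℝ) : Timed (ℕ × ℝ) := do
  tick
  match t with
  | leaf => pure (c₀, s₀)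
  | node _ _ _ l x r =>
    let c := c₀ + l.size + 1
    let s := s₀ + l.total + x.weight
    if goRight c s x.weight then search goRight r c s else search goRight l c₀ s₀

/-- Insert an item into a tree that is sorted by increasing weight. -/
def insertSorted (x : Item) (t : Tree) : Timed Tree := do
  tick
  let p ← search (fun _ _ v => v < x.weight) t 0 0
  let q ← splitAt p.1 t
  join q.1 x q.2

end Tree

/-- The reservoir: the large items (`w > τ`, adjusted weight `w`) in a tree sorted by weight, the
small items (adjusted weight `τ`) in a tree in arbitrary order, the threshold `τ`, and the smallest
large weight (`none` if there is no large item). -/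
structure State where
  large : Tree
  small : Tree
  τ : ℝ
  minLarge : Option ℝ

/-- The empty reservoir. -/
def State.init : State := ⟨Tree.leaf, Tree.leaf, 0, none⟩

/-- The logarithmic-time processing of the new item `x` with a full reservoir, with random number
`u`. If `light`, then `x` is treated as the first item of the order, outside both trees; otherwise
it is inserted into the tree of large items. -/
def slowStep (s : State) (x : Item) (u : ℝ) (light : Bool) : Timed State := do
  tick
  let L ← if light then pure s.large else Tree.insertSorted x s.large
  -- number and total adjusted weight of `x`, if light
  let cx : ℕ := if light then 1 else 0
  let wx : ℝ := if light then x.weight else 0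
  -- number and total adjusted weight of everything outside the tree of large items
  let c₀ : ℕ := cx + s.small.size
  let s₀ : ℝ := wx + s.small.size * s.τ
  -- the largest `t` such that the `t` smallest adjusted weights sum to at least
  -- `t - 1` times the `t`-th one; `p.1` of the `t` items are in `L`
  let p ← Tree.search (fun c S v => (((c₀ + c : ℕ) : ℝ) - 1) * v ≤ s₀ + S) L 0 0
  let t : ℕ := c₀ + p.1
  -- the new threshold
  let τ : ℝ := (s₀ + p.2) / ((t : ℝ) - 1)
  -- the item to drop is the first one, `d`, such that `d τ` minus the total adjusted weight of the
  -- first `d` items is at least `u τ`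
  if light = true ∧ u * τ ≤ τ - x.weight then
    -- `x` itself is dropped
    let q ← Tree.splitAt p.1 L
    let T ← Tree.concat s.small q.1
    let m ← Tree.firstWeight q.2
    pure ⟨q.2, T, τ, m⟩
  else if u * τ ≤ c₀ * τ - s₀ then
    -- a small item is dropped
    let d ← Tree.search
      (fun c _ _ => ((cx + c : ℕ) : ℝ) * τ - (wx + c * s.τ) < u * τ) s.small 0 0
    let T₁ ← Tree.deleteAt d.1 s.small
    let q ← Tree.splitAt p.1 L
    let T₂ ← Tree.concat T₁ q.1
    let T ← if light then Tree.join T₂ x Tree.leaf else pure T₂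
    let m ← Tree.firstWeight q.2
    pure ⟨q.2, T, τ, m⟩
  else
    -- an item of `L` is dropped
    let d ← Tree.search
      (fun c S _ => c₀ + c ≤ t ∧ ((c₀ + c : ℕ) : ℝ) * τ - (s₀ + S) < u * τ) L 0 0
    let L₁ ← Tree.deleteAt d.1 L
    let q ← Tree.splitAt (p.1 - 1) L₁
    let T₂ ← Tree.concat s.small q.1
    let T ← if light then Tree.join T₂ x Tree.leaf else pure T₂
    let m ← Tree.firstWeight q.2
    pure ⟨q.2, T, τ, m⟩

/-- The processing of one item with capacity `k` and random number `u`, with the constant-time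
treatment of the simple case. -/
def step (k : ℕ) (s : State) (x : Item) (u : ℝ) : Timed State := do
  tick
  if s.large.size + s.small.size < k then
    -- the reservoir is not yet full: include the item
    let L ← Tree.insertSorted x s.large
    let m ← Tree.firstWeight L
    pure ⟨L, s.small, s.τ, m⟩
  else
    -- the tentative new threshold
    let τ : ℝ := (x.weight + s.small.size * s.τ) / s.small.size
    if s.small.size = 0 ∨ τ ≤ x.weight ∨ (∃ v, s.minLarge = some v ∧ v ≤ τ) then
      slowStep s x u (decide (x.weight ≤ s.τ))
    else if u * τ ≤ τ - x.weight then
      -- the simple case: the item is skipped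
      pure { s with τ := τ }
    else
      slowStep s x u true

/-- Process a stream of items, each with the random number that is available for it. -/
def run (k : ℕ) : State → List (Item × ℝ) → Timed State
  | s, [] => pure s
  | s, (x, u) :: rest => do
    let s' ← step k s x u
    run k s' rest

/-- The stream in which item number `σ i`, with weight `w (σ i)`, arrives in round `i`, together
with the random number `u i` of this round. -/
def stream {n : ℕ} (w : Fin n → ℝ) (σ : Equiv.Perm (Fin n)) (u : Fin n → ℝ) : List (Item × ℝ) :=
  List.ofFn fun i => (⟨(σ i : ℕ), w (σ i)⟩, u i)

/-- The number of steps spent on the stream `stream w σ u` with capacity `k`. -/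
def time (k : ℕ) {n : ℕ} (w : Fin n → ℝ) (σ : Equiv.Perm (Fin n)) (u : Fin n → ℝ) : ℕ :=
  (run k State.init (stream w σ u)).steps

/-- The law of `n` independent uniformly random numbers in `(0, 1)`. -/
def uniformNumbers (n : ℕ) : MeasureTheory.Measure (Fin n → ℝ) :=
  MeasureTheory.Measure.pi fun _ => MeasureTheory.volume.restrict (Set.Ioo (0 : ℝ) 1)

/-- The expected number of steps on the weights `w`, arriving in a uniformly random order that is
independent of the random numbers of the algorithm. -/
def expectedTime (k : ℕ) {n : ℕ} (w : Fin n → ℝ) : ℝ :=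
  (∑ σ : Equiv.Perm (Fin n), ∫ u, (time k w σ u : ℝ) ∂uniformNumbers n) / (n.factorial : ℝ)

end VarOpt

end

noncomputable section

namespace VarOpt

/-! The proof is an amortized analysis whose random part reduces to a deterministic threshold for
each prefix of the stream.

A tree operation on at most `N` items costs O(log N), so a round on the tree path costs at most
`slowCost N`. Take `slowCost N` times |L| as potential. Call a round included if the reservoir is
not yet full before it, or if τ' - w < u τ' for its new threshold τ' (`Included`). An included round
raises |L| by at most one and is charged 2 `slowCost N`. Otherwise w ≤ τ', and there are two cases.
Either a large item becomes small, and the drop in potential pays for the round. Or L is unchanged,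
and conservation of the total adjusted weight forces τ' = (w + |T|τ)/|T|: this is exactly the simple
case, of cost 1 (`Inv.large_size_lt_or`, `step_full`). Hence the time is at most n plus 2 `slowCost
N` times the number of included rounds (`time_le`).

The threshold after a full prefix A with more than k items solves ∑ min(1, a/τ) = k, and the
solution is unique (`IsThreshold.unique`). It thus depends neither on the order within A nor on the
random numbers. Given the order, a round is therefore included with probability at most min(1, w/τ),
and these values add up to k over A. In a random order every item of A is equally likely to be the
last, so round i + 1 is included with probability at most min(1, k/(i+1)) (`sum_perm_inclProb_le`).
The sum over the rounds is at most n and at most k(1 + log n). -/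

@[simp] theorem Timed.pure_val {α : Type} (a : α) : (pure a : Timed α).val = a := rfl

@[simp] theorem Timed.pure_steps {α : Type} (a : α) : (pure a : Timed α).steps = 0 := rfl

@[simp] theorem Timed.bind_val {α β : Type} (x : Timed α) (f : α → Timed β) :
    (x >>= f).val = (f x.val).val := rfl

@[simp] theorem Timed.bind_steps {α β : Type} (x : Timed α) (f : α → Timed β) :
    (x >>= f).steps = x.steps + (f x.val).steps := rfl

@[simp] theorem tick_steps : tick.steps = 1 := rfl

/-! ### AVL trees: correctness and cost of the operations. -/

namespace Tree

/-- The weights of the items, from left to right. -/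
def wts : Tree → List ℝ
  | leaf => []
  | node _ _ _ l x r => wts l ++ x.weight :: wts r

/-- The cached data are correct, and the heights of siblings differ by at most one. -/
def Valid : Tree → Prop
  | leaf => True
  | node h n s l x r => Valid l ∧ Valid r ∧ h = max l.height r.height + 1 ∧
      n = l.size + 1 + r.size ∧ s = l.total + x.weight + r.total ∧
      l.height ≤ r.height + 1 ∧ r.height ≤ l.height + 1

@[simp] theorem wts_leaf : wts leaf = [] := rfl

@[simp] theorem wts_node (h n : ℕ) (s : ℝ) (l : Tree) (x : Item) (r : Tree) :
    wts (node h n s l x r) = wts l ++ x.weight :: wts r := rfl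

@[simp] theorem wts_mk (l : Tree) (x : Item) (r : Tree) :
    wts (mk l x r) = wts l ++ x.weight :: wts r := rfl

@[simp] theorem height_leaf : height leaf = 0 := rfl

@[simp] theorem height_node (h n : ℕ) (s : ℝ) (l : Tree) (x : Item) (r : Tree) :
    height (node h n s l x r) = h := rfl

@[simp] theorem height_mk (l : Tree) (x : Item) (r : Tree) :
    height (mk l x r) = max l.height r.height + 1 := rfl

theorem valid_mk {l : Tree} {x : Item} {r : Tree} : Valid (mk l x r) ↔ Valid l ∧ Valid r ∧
    l.height ≤ r.height + 1 ∧ r.height ≤ l.height + 1 := by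
  simp [mk, Valid]

theorem Valid.size_eq {t : Tree} (ht : Valid t) : t.size = t.wts.length := by
  induction t with
  | leaf => rfl
  | node h n s l x r ihl ihr =>
    obtain ⟨hl, hr, -, hn, -⟩ := ht
    have := ihl hl
    have := ihr hr
    change n = _
    simp only [wts_node, List.length_append, List.length_cons]
    omega

theorem Valid.total_eq {t : Tree} (ht : Valid t) : t.total = t.wts.sum := by
  induction t with
  | leaf => rfl
  | node h n s l x r ihl ihr =>
    obtain ⟨hl, hr, -, -, hs, -⟩ := ht
    change s = _
    rw [hs, wts_node, List.sum_append, List.sum_cons, ihl hl, ihr hr]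
    ring

theorem Valid.height_eq_zero {t : Tree} (ht : Valid t) (h : t.height = 0) : t = leaf := by
  cases t with
  | leaf => rfl
  | node => obtain ⟨-, -, h', -⟩ := ht; simp at h; omega

/-- Both subtrees of a node of height h have height at least h - 2, so the number of items plus one
at least doubles every two levels. -/
theorem Valid.two_pow_height_le {t : Tree} (ht : Valid t) : 2 ^ (t.height / 2) ≤ t.size + 1 := by
  induction t with
  | leaf => simp [size]
  | node h n s l x r ihl ihr =>
    obtain ⟨hl, hr, hh, hn, -, h1, h2⟩ := ht
    simp only [height_node, size]
    rcases Nat.lt_or_ge h 2 with h3 | h3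
    · rw [Nat.div_eq_of_lt h3]; omega
    · have e : h / 2 = (h - 2) / 2 + 1 := by omega
      have a := (Nat.pow_le_pow_right (n := 2) (by norm_num)
        (show (h - 2) / 2 ≤ l.height / 2 by omega)).trans (ihl hl)
      have b := (Nat.pow_le_pow_right (n := 2) (by norm_num)
        (show (h - 2) / 2 ≤ r.height / 2 by omega)).trans (ihr hr)
      rw [e, pow_succ]; omega

/-- A bound on the height of an AVL tree with `N` items. -/
def maxHeight (N : ℕ) : ℕ := 2 * Nat.log 2 (N + 1) + 1

theorem Valid.height_le {t : Tree} (ht : Valid t) {N : ℕ} (hN : t.size ≤ N) :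
    t.height ≤ maxHeight N := by
  have := Nat.le_log_of_pow_le (b := 2) (by norm_num)
    (ht.two_pow_height_le.trans (Nat.add_le_add_right hN 1))
  unfold maxHeight; omega

/-- The hypotheses describe a node whose right subtree has just grown. The last clause, on the case
without rotation, is what shows in `joinRight_spec` that a join never lowers the height. -/
theorem balance_right {l : Tree} {x : Item} {r : Tree} (hl : Valid l) (hr : Valid r)
    (h1 : l.height ≤ r.height + 1) (h2 : r.height ≤ l.height + 2) :
    Valid (balance l x r) ∧ wts (balance l x r) = wts l ++ x.weight :: wts r ∧
      max l.height r.height ≤ (balance l x r).height ∧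
      (balance l x r).height ≤ max l.height r.height + 1 ∧
      (r.height ≤ l.height + 1 → (balance l x r).height = max l.height r.height + 1) := by
  unfold balance
  rw [if_neg (by omega)]
  split_ifs with h
  · cases r with
    | leaf => simp at h
    | node hh n s rl y rr =>
      obtain ⟨hrl, hrr, e, -, -, e1, e2⟩ := hr
      simp only [height_node] at h h1 h2
      dsimp only
      split_ifs with h3
      · refine ⟨valid_mk.2 ⟨valid_mk.2 ⟨hl, hrl, ?_, ?_⟩, hrr, ?_, ?_⟩, ?_, ?_, ?_, ?_⟩ <;>
          first | omega | (simp; done) | (simp; omega)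
      · cases rl with
        | leaf => simp at h3
        | node h' n' s' a z b =>
          obtain ⟨ha, hb, e', -, -, e1', e2'⟩ := hrl
          simp only [height_node] at h3 e e1 e2
          refine ⟨valid_mk.2 ⟨valid_mk.2 ⟨hl, ha, ?_, ?_⟩, valid_mk.2 ⟨hb, hrr, ?_, ?_⟩, ?_, ?_⟩,
            ?_, ?_, ?_, ?_⟩ <;>
          first | omega | (simp; done) | (simp; omega)
  · refine ⟨valid_mk.2 ⟨hl, hr, ?_, ?_⟩, ?_, ?_, ?_, ?_⟩ <;>
          first | omega | simp

theorem balance_left {l : Tree} {x : Item} {r : Tree} (hl : Valid l) (hr : Valid r)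
    (h1 : r.height ≤ l.height + 1) (h2 : l.height ≤ r.height + 2) :
    Valid (balance l x r) ∧ wts (balance l x r) = wts l ++ x.weight :: wts r ∧
      max l.height r.height ≤ (balance l x r).height ∧
      (balance l x r).height ≤ max l.height r.height + 1 ∧
      (l.height ≤ r.height + 1 → (balance l x r).height = max l.height r.height + 1) := by
  unfold balance
  split_ifs with h h'
  · cases l with
    | leaf => simp at h
    | node hh n s ll y lr =>
      obtain ⟨hll, hlr, e, -, -, e1, e2⟩ := hl
      simp only [height_node] at h h1 h2
      dsimp only
      split_ifs with h3
      · refine ⟨valid_mk.2 ⟨hll, valid_mk.2 ⟨hlr, hr, ?_, ?_⟩, ?_, ?_⟩, ?_, ?_, ?_, ?_⟩ <;>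
          first | omega | (simp; done) | (simp; omega)
      · cases lr with
        | leaf => simp at h3
        | node h' n' s' a z b =>
          obtain ⟨ha, hb, e', -, -, e1', e2'⟩ := hlr
          simp only [height_node] at h3 e e1 e2
          refine ⟨valid_mk.2 ⟨valid_mk.2 ⟨hll, ha, ?_, ?_⟩, valid_mk.2 ⟨hb, hr, ?_, ?_⟩, ?_, ?_⟩,
            ?_, ?_, ?_, ?_⟩ <;>
          first | omega | (simp; done) | (simp; omega)
  · omega
  · refine ⟨valid_mk.2 ⟨hl, hr, ?_, ?_⟩, ?_, ?_, ?_, ?_⟩ <;>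
          first | omega | simp

theorem joinRight_spec {l : Tree} {x : Item} {r : Tree} (hl : Valid l) (hr : Valid r)
    (h : r.height ≤ l.height) :
    Valid (joinRight l x r).val ∧ wts (joinRight l x r).val = wts l ++ x.weight :: wts r ∧
      l.height ≤ (joinRight l x r).val.height ∧ (joinRight l x r).val.height ≤ l.height + 1 ∧
      (joinRight l x r).steps ≤ l.height - r.height + 1 := by
  induction l with
  | leaf =>
    have := hr.height_eq_zero (by simpa using h)
    subst this
    simp [joinRight, valid_mk, Valid]
  | node hh n s ll y lr ihl ihr =>
    have hl' := hl
    obtain ⟨hll, hlr, e, -, -, e1, e2⟩ := hl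
    simp only [height_node] at h
    rw [joinRight]
    simp only [Timed.bind_val, Timed.bind_steps, tick_steps, height_node]
    split_ifs with h3
    · refine ⟨valid_mk.2 ⟨hl', hr, ?_, ?_⟩, ?_, ?_, ?_, ?_⟩ <;>
          first | omega | (simp; done) | (simp; omega)
    · obtain ⟨i1, i2, i3, i4, i5⟩ := ihr hlr (by omega)
      obtain ⟨b1, b2, b3, b4, b5⟩ :=
        balance_right (x := y) hll i1 (by omega) (by omega)
      simp only [Timed.bind_val, Timed.bind_steps, Timed.pure_val, Timed.pure_steps]
      refine ⟨b1, ?_, ?_, ?_, ?_⟩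
      · rw [b2, i2]; simp
      · by_cases hc : (joinRight lr x r).val.height ≤ ll.height + 1
        · have := b5 hc; omega
        · omega
      · by_cases hc : (joinRight lr x r).val.height ≤ ll.height + 1
        · have := b5 hc; omega
        · omega
      · omega

theorem joinLeft_spec {l : Tree} {x : Item} {r : Tree} (hl : Valid l) (hr : Valid r)
    (h : l.height ≤ r.height) :
    Valid (joinLeft l x r).val ∧ wts (joinLeft l x r).val = wts l ++ x.weight :: wts r ∧
      r.height ≤ (joinLeft l x r).val.height ∧ (joinLeft l x r).val.height ≤ r.height + 1 ∧
      (joinLeft l x r).steps ≤ r.height - l.height + 1 := by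
  induction r with
  | leaf =>
    have := hl.height_eq_zero (by simpa using h)
    subst this
    simp [joinLeft, valid_mk, Valid]
  | node hh n s rl y rr ihl ihr =>
    have hr' := hr
    obtain ⟨hrl, hrr, e, -, -, e1, e2⟩ := hr
    simp only [height_node] at h
    rw [joinLeft]
    simp only [Timed.bind_val, Timed.bind_steps, tick_steps, height_node]
    split_ifs with h3
    · refine ⟨valid_mk.2 ⟨hl, hr', ?_, ?_⟩, ?_, ?_, ?_, ?_⟩ <;>
          first | omega | (simp; done) | (simp; omega)
    · obtain ⟨i1, i2, i3, i4, i5⟩ := ihl hrl (by omega)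
      obtain ⟨b1, b2, b3, b4, b5⟩ :=
        balance_left (x := y) i1 hrr (by omega) (by omega)
      simp only [Timed.bind_val, Timed.bind_steps, Timed.pure_val, Timed.pure_steps]
      refine ⟨b1, ?_, ?_, ?_, ?_⟩
      · rw [b2, i2]; simp
      · by_cases hc : (joinLeft l x rl).val.height ≤ rr.height + 1
        · have := b5 hc; omega
        · omega
      · by_cases hc : (joinLeft l x rl).val.height ≤ rr.height + 1
        · have := b5 hc; omega
        · omega
      · omega

/-- The cost is the difference of the heights up to a constant; it is stated additively to avoid
truncated subtraction and to telescope in `splitAt_spec`. -/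
theorem join_spec {l : Tree} (x : Item) {r : Tree} (hl : Valid l) (hr : Valid r) :
    Valid (join l x r).val ∧ wts (join l x r).val = wts l ++ x.weight :: wts r ∧
      max l.height r.height ≤ (join l x r).val.height ∧
      (join l x r).val.height ≤ max l.height r.height + 1 ∧
      (join l x r).steps + min l.height r.height ≤ max l.height r.height + 2 := by
  unfold join
  simp only [Timed.bind_val, Timed.bind_steps, tick_steps]
  split_ifs with h
  · obtain ⟨i1, i2, i3, i4, i5⟩ := joinRight_spec (x := x) hl hr h
    exact ⟨i1, i2, by omega, by omega, by omega⟩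
  · obtain ⟨i1, i2, i3, i4, i5⟩ := joinLeft_spec (x := x) hl hr (by omega)
    exact ⟨i1, i2, by omega, by omega, by omega⟩

/-- The heights of the two parts appear in the cost bound so that the join costs telescope along the
path: a join costs about the height difference, and its result is at least as high as both
arguments. The 4 per level pays for the call, the additive 2 of `join_spec`, and a sibling that may
be lower by one. -/
theorem splitAt_spec (i : ℕ) {t : Tree} (ht : Valid t) :
    Valid (splitAt i t).val.1 ∧ Valid (splitAt i t).val.2 ∧
      wts (splitAt i t).val.1 = (wts t).take i ∧ wts (splitAt i t).val.2 = (wts t).drop i ∧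
      (splitAt i t).val.1.height ≤ t.height ∧ (splitAt i t).val.2.height ≤ t.height ∧
      (splitAt i t).steps ≤
        (splitAt i t).val.1.height + (splitAt i t).val.2.height + 4 * t.height + 1 := by
  induction t generalizing i with
  | leaf => simp [splitAt, Valid]
  | node h n s l x r ihl ihr =>
    obtain ⟨hl, hr, e, -, -, e1, e2⟩ := ht
    have hsz := hl.size_eq
    rw [splitAt]
    simp only [Timed.bind_val, Timed.bind_steps, tick_steps, height_node, wts_node]
    split_ifs with hi
    · obtain ⟨i1, i2, i3, i4, i5, i6, i7⟩ := ihl i hl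
      obtain ⟨j1, j2, j3, j4, j5⟩ := join_spec x i2 hr
      simp only [Timed.bind_val, Timed.bind_steps, Timed.pure_val, Timed.pure_steps]
      refine ⟨i1, j1, ?_, ?_, by omega, by omega, by omega⟩
      · rw [i3, List.take_append_of_le_length (by omega)]
      · rw [j2, i4, List.drop_append_of_le_length (by omega)]
    · obtain ⟨m, rfl⟩ : ∃ m, i = l.wts.length + (m + 1) := ⟨i - l.wts.length - 1, by omega⟩
      rw [show l.wts.length + (m + 1) - (l.size + 1) = m by omega]
      obtain ⟨i1, i2, i3, i4, i5, i6, i7⟩ := ihr m hr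
      obtain ⟨j1, j2, j3, j4, j5⟩ := join_spec x hl i1
      simp only [Timed.bind_val, Timed.bind_steps, Timed.pure_val, Timed.pure_steps]
      refine ⟨j1, i2, ?_, ?_, by omega, by omega, by omega⟩
      · rw [j2, i3, List.take_length_add_append, List.take_succ_cons]
      · rw [i4, List.drop_length_add_append, List.drop_succ_cons]

theorem popFirst_spec {t : Tree} (ht : Valid t) :
    (t = leaf ∧ (popFirst t).val = none ∧ (popFirst t).steps = 1) ∨
    ∃ x t', (popFirst t).val = some (x, t') ∧ Valid t' ∧ wts t = x.weight :: wts t' ∧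
      t'.height ≤ t.height ∧ (popFirst t).steps ≤ t'.height + 4 * t.height + 2 := by
  induction t with
  | leaf => left; simp [popFirst]
  | node h n s l x r ihl ihr =>
    right
    obtain ⟨hl, hr, e, -, -, e1, e2⟩ := ht
    rw [popFirst]
    simp only [Timed.bind_val, Timed.bind_steps, tick_steps, height_node, wts_node]
    rcases ihl hl with ⟨rfl, h1, h2⟩ | ⟨y, l', h1, h2, h3, h4, h5⟩
    · rw [h1, h2]
      exact ⟨x, r, rfl, hr, rfl, by omega, by simp⟩
    · obtain ⟨j1, j2, j3, j4, j5⟩ := join_spec x h2 hr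
      rw [h1]
      refine ⟨y, (join l' x r).val, rfl, j1, ?_, by omega, ?_⟩
      · rw [j2, h3]; simp
      · simp only [Timed.bind_steps, Timed.pure_steps]; omega

theorem firstWeight_spec (t : Tree) (ht : Valid t) :
    (firstWeight t).val = (wts t).head? ∧ (firstWeight t).steps ≤ t.height + 1 := by
  induction t with
  | leaf => simp [firstWeight]
  | node h n s l x r ihl ihr =>
    obtain ⟨hl, hr, e, -, -, e1, e2⟩ := ht
    obtain ⟨h1, h2⟩ := ihl hl
    rw [firstWeight]
    simp only [Timed.bind_val, Timed.bind_steps, tick_steps, Timed.pure_val, Timed.pure_steps, h1,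
      height_node, wts_node]
    refine ⟨?_, by omega⟩
    cases l.wts <;> simp

theorem concat_spec {a b : Tree} (ha : Valid a) (hb : Valid b) :
    Valid (concat a b).val ∧ wts (concat a b).val = wts a ++ wts b ∧
      (concat a b).steps ≤ a.height + 6 * b.height + 5 := by
  unfold concat
  simp only [Timed.bind_val, Timed.bind_steps, tick_steps]
  rcases popFirst_spec hb with ⟨rfl, h1, h2⟩ | ⟨y, b', h1, h2, h3, h4, h5⟩
  · rw [h1, h2]; simp [ha]
  · obtain ⟨j1, j2, j3, j4, j5⟩ := join_spec y ha h2
    rw [h1]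
    refine ⟨j1, ?_, ?_⟩
    · rw [h3]; exact j2
    · change 1 + ((popFirst b).steps + (join a y b').steps) ≤ _
      omega

theorem deleteAt_spec {t : Tree} (ht : Valid t) (i : ℕ) :
    Valid (deleteAt i t).val ∧ wts (deleteAt i t).val = (wts t).take i ++ (wts t).drop (i + 1) ∧
      (deleteAt i t).steps ≤ 20 * t.height + 10 := by
  unfold deleteAt
  simp only [Timed.bind_val, Timed.bind_steps, tick_steps]
  obtain ⟨i1, i2, i3, i4, i5, i6, i7⟩ := splitAt_spec i ht
  have hd : (wts t).drop (i + 1) = ((wts t).drop i).tail := by simp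
  rcases popFirst_spec i2 with ⟨h0, h1, h2⟩ | ⟨y, b', h1, h2, h3, h4, h5⟩
  · rw [h1, h2]
    refine ⟨i1, ?_, ?_⟩
    · rw [hd, ← i4, h0]; simp [i3]
    · simp only [Timed.pure_steps]; omega
  · obtain ⟨j1, j2, j3⟩ := concat_spec i1 h2
    rw [h1]
    refine ⟨j1, ?_, ?_⟩
    · rw [hd, ← i4, h3, ← i3]; exact j2
    · change 1 + ((splitAt i t).steps + ((popFirst (splitAt i t).val.2).steps +
        (concat (splitAt i t).val.1 b').steps)) ≤ _
      omega

/-- Without any monotonicity of `goRight`, the search ends at a place where the test succeeds at the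
last item before and fails at the first item after. These two boundary facts are all that is used
about the searches. -/
theorem search_spec (goRight : ℕ → ℝ → ℝ → Prop) [∀ c s v, Decidable (goRight c s v)]
    {t : Tree} (ht : Valid t) (c₀ : ℕ) (s₀ : ℝ) :
    (search goRight t c₀ s₀).steps ≤ t.height + 1 ∧ ∃ a b, wts t = a ++ b ∧
      (search goRight t c₀ s₀).val = (c₀ + a.length, s₀ + a.sum) ∧
      (∀ a' v, a = a' ++ [v] → goRight (c₀ + a.length) (s₀ + a.sum) v) ∧
      (∀ v b', b = v :: b' → ¬ goRight (c₀ + a.length + 1) (s₀ + a.sum + v) v) := by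
  induction t generalizing c₀ s₀ with
  | leaf => exact ⟨by simp [search], [], [], by simp [search]⟩
  | node h n s l x r ihl ihr =>
    obtain ⟨hl, hr, e, -, -, e1, e2⟩ := ht
    rw [search]
    simp only [Timed.bind_val, Timed.bind_steps, tick_steps, height_node, wts_node]
    rw [hl.size_eq, hl.total_eq]
    split_ifs with hg
    · obtain ⟨hs, a, b, h1, h2, h3, h4⟩ := ihr hr (c₀ + l.wts.length + 1)
        (s₀ + l.wts.sum + x.weight)
      have ec : c₀ + (l.wts ++ x.weight :: a).length = c₀ + l.wts.length + 1 + a.length := by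
        simp; omega
      have es : s₀ + (l.wts ++ x.weight :: a).sum = s₀ + l.wts.sum + x.weight + a.sum := by
        simp; ring
      refine ⟨by omega, l.wts ++ x.weight :: a, b, by simp [h1], ?_, ?_, ?_⟩
      · rw [h2, ec, es]
      · intro a' v hv
        rw [ec, es]
        rcases List.eq_nil_or_concat' a with rfl | ⟨a'', v', rfl⟩
        · obtain ⟨-, hv⟩ := List.append_inj' hv rfl
          simp only [List.cons.injEq, and_true] at hv
          simpa [← hv] using hg
        · rw [← List.cons_append, ← List.append_assoc] at hv
          obtain ⟨-, hv⟩ := List.append_inj' hv rfl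
          simp only [List.cons.injEq, and_true] at hv
          exact h3 a'' v (by rw [hv])
      · intro v b' hb
        rw [ec, es]
        exact h4 v b' hb
    · obtain ⟨hs, a, b, h1, h2, h3, h4⟩ := ihl hl c₀ s₀
      refine ⟨by omega, a, b ++ x.weight :: r.wts, by simp [h1], h2, h3, ?_⟩
      intro v b' hb
      cases b with
      | nil =>
        simp only [List.nil_append, List.cons.injEq] at hb
        rw [List.append_nil] at h1
        rw [← hb.1, ← h1]
        exact hg
      | cons v' b'' =>
        simp only [List.cons_append, List.cons.injEq] at hb
        exact h4 v b'' (by rw [hb.1])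

theorem insertSorted_spec {t : Tree} (ht : Valid t) (hs : t.wts.SortedLE) (x : Item) :
    Valid (insertSorted x t).val ∧ (insertSorted x t).val.wts.SortedLE ∧
      ((insertSorted x t).val.wts : Multiset ℝ) = x.weight ::ₘ (t.wts : Multiset ℝ) ∧
      (insertSorted x t).steps ≤ 10 * t.height + 10 := by
  unfold insertSorted
  simp only [Timed.bind_val, Timed.bind_steps, tick_steps]
  obtain ⟨c, a, b, h1, h2, h3, h4⟩ := search_spec (fun _ _ v => v < x.weight) ht 0 0
  have hp : (search (fun _ _ v => v < x.weight) t 0 0).val.1 = a.length := by rw [h2]; simp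
  rw [hp]
  obtain ⟨i1, i2, i3, i4, i5, i6, i7⟩ := splitAt_spec a.length ht
  obtain ⟨j1, j2, j3, j4, j5⟩ := join_spec x i1 i2
  rw [h1, List.take_left] at i3
  rw [h1, List.drop_left] at i4
  rw [i3, i4] at j2
  have hs' := hs.pairwise
  rw [h1, List.pairwise_append] at hs'
  obtain ⟨pa, pb, pab⟩ := hs'
  refine ⟨j1, ?_, ?_, by omega⟩
  · rw [j2]
    apply List.Pairwise.sortedLE
    have ha : ∀ v ∈ a, v ≤ x.weight := by
      rcases List.eq_nil_or_concat' a with rfl | ⟨a', v', rfl⟩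
      · simp
      · intro v hv
        have hv' := h3 a' v' rfl
        rcases List.mem_append.1 hv with hv | hv
        · exact ((List.pairwise_append.1 pa).2.2 v hv v' (by simp)).trans hv'.le
        · rw [List.mem_singleton.1 hv]; exact hv'.le
    have hb : ∀ v ∈ b, x.weight ≤ v := by
      cases b with
      | nil => simp
      | cons v' b' =>
        have hv' := not_lt.1 (h4 v' b' rfl)
        intro v hv
        rcases List.mem_cons.1 hv with rfl | hv
        · exact hv'
        · exact hv'.trans ((List.pairwise_cons.1 pb).1 v hv)
    rw [List.pairwise_append]
    refine ⟨pa, List.pairwise_cons.2 ⟨hb, pb⟩, ?_⟩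
    intro y hy z hz
    rcases List.mem_cons.1 hz with rfl | hz
    · exact ha y hy
    · exact pab y hy z hz
  · rw [j2, h1, Multiset.cons_coe, Multiset.coe_eq_coe]
    exact List.perm_middle

end Tree

end VarOpt

/-! ### The reservoir invariant and the tree implementation. -/

namespace VarOpt

/-- The invariant of the reservoir after the arrival of items with the multiset `A` of weights. -/
structure Inv (k : ℕ) (A : Multiset ℝ) (s : State) : Prop where
  large_valid : s.large.Valid
  small_valid : s.small.Valid
  sorted : s.large.wts.SortedLE
  large_eq : (s.large.wts : Multiset ℝ) = A.filter (s.τ < ·)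
  -- The adjusted weights preserve the total weight exactly. Which items are small is random, and
  -- the invariant records only their number.
  total : s.small.size * s.τ + s.large.wts.sum = A.sum
  card : s.large.size + s.small.size = min k A.card
  nonneg : 0 ≤ s.τ
  small_eq_zero : s.small.size = 0 ↔ s.τ = 0
  minLarge_eq : s.minLarge = s.large.wts.head?
  pos : ∀ a ∈ A, 0 < a
  filling : A.card ≤ k → s.τ = 0

theorem Inv.init (k : ℕ) : Inv k 0 State.init := by
  constructor <;> simp [State.init, Tree.Valid, Tree.size, List.Pairwise.nil.sortedLE]
  exact (Multiset.filter_zero _).symm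

theorem Inv.lt_of_mem {k : ℕ} {A : Multiset ℝ} {s : State} (h : Inv k A s) {v : ℝ}
    (hv : v ∈ s.large.wts) : s.τ < v := by
  have : v ∈ (s.large.wts : Multiset ℝ) := hv
  rw [h.large_eq] at this
  exact (Multiset.mem_filter.1 this).2

/-- The number of steps of a tree operation sequence on at most `N` items. -/
def slowCost (N : ℕ) : ℕ := 50 * Tree.maxHeight N + 50

theorem mul_length_le_sum {a : List ℝ} {c : ℝ} (h : ∀ v ∈ a, c ≤ v) : a.length * c ≤ a.sum := by
  have := List.card_nsmul_le_sum a c h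
  rwa [nsmul_eq_mul] at this

/-- The test at the last item of `a` says that it is at most τ', and its failure at the first item
of `b` says that this one exceeds τ'; sortedness extends both to the whole lists. Here `c₀` and `s₀`
are the number and adjusted weight of the items outside the tree of large items. -/
theorem newThreshold_spec {c₀ : ℕ} {s₀ τ τ' : ℝ} {a b : List ℝ} (hs : (a ++ b).SortedLE)
    (hτ : 0 ≤ τ) (hgt : ∀ v ∈ a ++ b, τ < v) (hlen : 2 ≤ c₀ + (a ++ b).length) (hs₀ : 0 ≤ s₀)
    (hs₀' : 2 ≤ c₀ → 0 < s₀) (hc : ((c₀ : ℝ) - 1) * τ ≤ s₀)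
    (ha : ∀ a' v, a = a' ++ [v] → (((c₀ + a.length : ℕ) : ℝ) - 1) * v ≤ s₀ + a.sum)
    (hb : ∀ v b', b = v :: b' →
      ¬ (((c₀ + (a.length + 1) : ℕ) : ℝ) - 1) * v ≤ s₀ + (a.sum + v))
    (hτ' : τ' = (s₀ + a.sum) / (((c₀ + a.length : ℕ) : ℝ) - 1)) :
    2 ≤ c₀ + a.length ∧ 0 < τ' ∧ τ ≤ τ' ∧ (∀ v ∈ a, v ≤ τ') ∧ (∀ v ∈ b, τ' < v) ∧
      (((c₀ + a.length : ℕ) : ℝ) - 1) * τ' = s₀ + a.sum := by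
  have hsum : a.length * τ ≤ a.sum :=
    mul_length_le_sum fun v hv => (hgt v (List.mem_append_left _ hv)).le
  have hsum0 : 0 ≤ a.sum := le_trans (by positivity) hsum
  -- With at most one item so far, the factor at the next item v is at most 1, so the test would
  -- succeed there. Hence the denominator of τ' is at least 1.
  have ht : 2 ≤ c₀ + a.length := by
    by_contra! hlt
    cases b with
    | nil => simp at hlen; omega
    | cons v b' =>
      have hv : 0 < v := hτ.trans_lt (hgt v (by simp))
      have := hb v b' rfl
      have h1 : (((c₀ + (a.length + 1) : ℕ) : ℝ) - 1) ≤ 1 := by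
        have : (((c₀ + (a.length + 1) : ℕ) : ℝ)) ≤ ((2 : ℕ) : ℝ) := by exact_mod_cast (by omega)
        push_cast at this ⊢; linarith
      nlinarith
  have ht' : (1 : ℝ) ≤ ((c₀ + a.length : ℕ) : ℝ) - 1 := by
    have : ((2 : ℕ) : ℝ) ≤ ((c₀ + a.length : ℕ) : ℝ) := by exact_mod_cast ht
    push_cast at this ⊢; linarith
  have hmul : (((c₀ + a.length : ℕ) : ℝ) - 1) * τ' = s₀ + a.sum := by
    rw [hτ']; field_simp
  have hpos : 0 < s₀ + a.sum := by
    cases a with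
    | nil => simp at ht ⊢; exact hs₀' ht
    | cons v a' =>
      have hv : 0 < v := hτ.trans_lt (hgt v (by simp))
      have : 0 ≤ a'.sum := List.sum_nonneg fun y hy => hτ.trans (hgt y (by simp [hy])).le
      rw [List.sum_cons]; linarith
  have hp := hs.pairwise
  rw [List.pairwise_append] at hp
  obtain ⟨pa, pb, pab⟩ := hp
  refine ⟨ht, ?_, ?_, ?_, ?_, hmul⟩
  · rw [hτ']; exact div_pos hpos (by linarith)
  · rw [hτ', le_div_iff₀ (by linarith)]
    push_cast; linarith
  · rcases List.eq_nil_or_concat' a with rfl | ⟨a', v', rfl⟩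
    · simp
    · have hv' : v' ≤ τ' := by
        rw [hτ', le_div_iff₀ (by linarith), mul_comm]
        exact ha a' v' rfl
      intro v hv
      rcases List.mem_append.1 hv with hv | hv
      · exact ((List.pairwise_append.1 pa).2.2 v hv v' (by simp)).trans hv'
      · rw [List.mem_singleton.1 hv]; exact hv'
  · cases b with
    | nil => simp
    | cons v' b' =>
      have hv' : τ' < v' := by
        rw [hτ', div_lt_iff₀ (by linarith)]
        have := hb v' b' rfl
        push_cast at this ⊢; linarith
      intro v hv
      rcases List.mem_cons.1 hv with rfl | hv
      · exact hv'
      · exact hv'.trans_le ((List.pairwise_cons.1 pb).1 v hv)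

/-- Common to the three branches of the slow step: they differ in the dropped item, but the
invariant only sees that the first t items leave t - 1 small ones. -/
theorem Inv.update {k : ℕ} {A : Multiset ℝ} {s : State} (h : Inv k A s) (hfull : k ≤ A.card)
    {w : ℝ} (hw : 0 < w) {light : Bool} {a b : List ℝ}
    (hab : ((a ++ b : List ℝ) : Multiset ℝ) =
      (if light = true then 0 else {w}) + A.filter (s.τ < ·))
    (hs : (a ++ b).SortedLE) {τ' : ℝ} (hττ' : s.τ ≤ τ') (hτ' : 0 < τ') (ha : ∀ v ∈ a, v ≤ τ')
    (hb : ∀ v ∈ b, τ' < v) (hlight : light = true → w ≤ τ')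
    (ht : 2 ≤ (if light = true then 1 else 0) + s.small.size + a.length)
    (hmul : ((((if light = true then 1 else 0) + s.small.size + a.length : ℕ) : ℝ) - 1) * τ' =
      (if light = true then w else 0) + s.small.size * s.τ + a.sum)
    {L T : Tree} (hL : L.Valid) (hT : T.Valid) (hLb : L.wts = b)
    (hTs : T.wts.length + 1 = (if light = true then 1 else 0) + s.small.size + a.length) :
    Inv k (w ::ₘ A) ⟨L, T, τ', b.head?⟩ := by
  have hsub : ((A.filter (s.τ < ·)).filter (τ' < ·)) = A.filter (τ' < ·) := by
    rw [Multiset.filter_filter]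
    exact Multiset.filter_congr fun v _ => ⟨fun h => h.1, fun h => ⟨h, hττ'.trans_lt h⟩⟩
  have hfb : ((a ++ b : List ℝ) : Multiset ℝ).filter (τ' < ·) = b := by
    rw [← Multiset.coe_add, Multiset.filter_add,
      Multiset.filter_eq_nil.2 fun v hv => not_lt.2 (ha v hv),
      Multiset.filter_eq_self.2 fun v hv => hb v hv, zero_add]
  have hAsum := h.total
  have hLsum : s.large.wts.sum = (A.filter (s.τ < ·)).sum := by
    rw [← h.large_eq, Multiset.sum_coe]
  have hLcard : s.large.size = (A.filter (s.τ < ·)).card := by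
    rw [← h.large_eq, Multiset.coe_card, h.large_valid.size_eq]
  have habs := congrArg Multiset.sum hab
  have habc := congrArg Multiset.card hab
  rw [Multiset.sum_coe, List.sum_append, Multiset.sum_add, ← hLsum] at habs
  rw [Multiset.coe_card, List.length_append, Multiset.card_add, ← hLcard] at habc
  have hTs' : ((T.wts.length : ℕ) : ℝ) =
      (((if light = true then 1 else 0) + s.small.size + a.length : ℕ) : ℝ) - 1 := by
    rw [← hTs]; push_cast; ring
  have hcard := h.card
  refine ⟨hL, hT, ?_, ?_, ?_, ?_, hτ'.le, ?_, ?_, ?_, ?_⟩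
  · dsimp only
    rw [hLb]
    exact (List.pairwise_append.1 hs.pairwise).2.1.sortedLE
  · dsimp only
    rw [hLb, ← hfb, hab, Multiset.filter_add, hsub]
    cases light with
    | true => simp [Multiset.filter_cons_of_neg, hlight rfl]
    | false =>
      simp only [Bool.false_eq_true, if_false, Multiset.filter_cons,
        Multiset.filter_singleton]
      rfl
  · dsimp only
    rw [hT.size_eq, hTs', hmul, hLb, Multiset.sum_cons, ← hAsum]
    cases light <;> simp at habs ⊢ <;> linarith
  · dsimp only
    rw [hL.size_eq, hT.size_eq, hLb, Multiset.card_cons]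
    cases light <;> simp at habc hTs <;> omega
  · dsimp only
    rw [hT.size_eq]
    exact ⟨fun h => by omega, fun h => absurd h hτ'.ne'⟩
  · dsimp only
    rw [hLb]
  · intro v hv
    rcases Multiset.mem_cons.1 hv with rfl | hv
    · exact hw
    · exact h.pos v hv
  · intro hc
    rw [Multiset.card_cons] at hc; omega

/-- The tree of large items, with `x` inserted unless it is light. -/
def insertHeavy (light : Bool) (x : Item) (L : Tree) : Timed Tree :=
  if light then pure L else Tree.insertSorted x L

/-- The tree of small items, with `x` appended if it is light. -/
def appendLight (light : Bool) (x : Item) (T : Tree) : Timed Tree :=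
  if light then Tree.join T x Tree.leaf else pure T

/-- The part of `slowStep` that follows the insertion into the tree of large items. -/
def slowStepTail (s : State) (x : Item) (u : ℝ) (light : Bool) (L : Tree) : Timed State := do
  let cx : ℕ := if light then 1 else 0
  let wx : ℝ := if light then x.weight else 0
  let c₀ : ℕ := cx + s.small.size
  let s₀ : ℝ := wx + s.small.size * s.τ
  let p ← Tree.search (fun c S v => (((c₀ + c : ℕ) : ℝ) - 1) * v ≤ s₀ + S) L 0 0
  let t : ℕ := c₀ + p.1
  let τ : ℝ := (s₀ + p.2) / ((t : ℝ) - 1)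
  if light = true ∧ u * τ ≤ τ - x.weight then
    let q ← Tree.splitAt p.1 L
    let T ← Tree.concat s.small q.1
    let m ← Tree.firstWeight q.2
    pure ⟨q.2, T, τ, m⟩
  else if u * τ ≤ c₀ * τ - s₀ then
    let d ← Tree.search
      (fun c _ _ => ((cx + c : ℕ) : ℝ) * τ - (wx + c * s.τ) < u * τ) s.small 0 0
    let T₁ ← Tree.deleteAt d.1 s.small
    let q ← Tree.splitAt p.1 L
    let T₂ ← Tree.concat T₁ q.1
    let T ← appendLight light x T₂
    let m ← Tree.firstWeight q.2
    pure ⟨q.2, T, τ, m⟩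
  else
    let d ← Tree.search
      (fun c S _ => c₀ + c ≤ t ∧ ((c₀ + c : ℕ) : ℝ) * τ - (s₀ + S) < u * τ) L 0 0
    let L₁ ← Tree.deleteAt d.1 L
    let q ← Tree.splitAt (p.1 - 1) L₁
    let T₂ ← Tree.concat s.small q.1
    let T ← appendLight light x T₂
    let m ← Tree.firstWeight q.2
    pure ⟨q.2, T, τ, m⟩

theorem slowStep_eq (s : State) (x : Item) (u : ℝ) (light : Bool) :
    slowStep s x u light = (do
      tick
      let L ← insertHeavy light x s.large
      slowStepTail s x u light L) := by
  cases light <;> rfl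

theorem insertHeavy_spec {t : Tree} (ht : t.Valid) (hs : t.wts.SortedLE) (light : Bool)
    (x : Item) :
    (insertHeavy light x t).val.Valid ∧ (insertHeavy light x t).val.wts.SortedLE ∧
      ((insertHeavy light x t).val.wts : Multiset ℝ) =
        (if light = true then 0 else {x.weight}) + (t.wts : Multiset ℝ) ∧
      (insertHeavy light x t).steps ≤ 10 * t.height + 10 := by
  cases light with
  | false =>
    obtain ⟨i1, i2, i3, i4⟩ := Tree.insertSorted_spec ht hs x
    exact ⟨i1, i2, by simpa [insertHeavy] using i3, i4⟩
  | true => exact ⟨ht, hs, by simp [insertHeavy], by simp [insertHeavy]⟩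

theorem appendLight_spec {t : Tree} (ht : t.Valid) (light : Bool) (x : Item) :
    (appendLight light x t).val.Valid ∧ (appendLight light x t).val.wts.length =
      t.wts.length + (if light = true then 1 else 0) ∧
      (appendLight light x t).steps ≤ t.height + 2 := by
  cases light with
  | false => exact ⟨ht, by simp [appendLight], by simp [appendLight]⟩
  | true =>
    obtain ⟨j1, j2, j3, j4, j5⟩ := Tree.join_spec x ht (r := Tree.leaf) trivial
    refine ⟨j1, ?_, ?_⟩
    · change (Tree.join t x Tree.leaf).val.wts.length = _
      rw [j2]; simp
    · change (Tree.join t x Tree.leaf).steps ≤ _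
      simp at j5; exact j5

/-- The condition on a light item covers both of its uses: w ≤ τ, and the fast path with w below the
tentative threshold and that below every large weight. -/
theorem slowStep_spec {k : ℕ} {A : Multiset ℝ} {s : State} (h : Inv k A s) (hk : 1 ≤ k)
    (hfull : k ≤ A.card) {x : Item} (hx : 0 < x.weight) {u : ℝ} (hu0 : 0 < u) (hu1 : u < 1)
    {light : Bool} (hlight : light = true → 1 ≤ s.small.size ∧
      s.small.size * x.weight ≤ x.weight + s.small.size * s.τ ∧
      ∀ v ∈ s.large.wts, x.weight ≤ v)
    (hheavy : light = false → s.τ < x.weight) {N : ℕ} (hN : k + 1 ≤ N) :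
    Inv k (x.weight ::ₘ A) (slowStep s x u light).val ∧
      s.τ ≤ (slowStep s x u light).val.τ ∧ (slowStep s x u light).steps ≤ slowCost N := by
  have hcard : s.large.size + s.small.size = k := by rw [h.card]; omega
  have hLsz := h.large_valid.size_eq
  have hTsz := h.small_valid.size_eq
  rw [slowStep_eq]
  simp only [Timed.bind_val, Timed.bind_steps, tick_steps]
  obtain ⟨hLv, hLs, hLe, hLc⟩ := insertHeavy_spec h.large_valid h.sorted light x
  rw [h.large_eq] at hLe
  generalize insertHeavy light x s.large = LT at *
  obtain ⟨L, Lsteps⟩ := LT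
  dsimp only at *
  unfold slowStepTail
  simp only [Timed.bind_val, Timed.bind_steps]
  set cx : ℕ := if light = true then 1 else 0 with hcx
  set wx : ℝ := if light = true then x.weight else 0 with hwx
  obtain ⟨hpc, a, b, hab, hpv, ha, hb⟩ := Tree.search_spec
    (fun c S v => (((cx + s.small.size + c : ℕ) : ℝ) - 1) * v ≤ wx + s.small.size * s.τ + S)
    hLv 0 0
  generalize (Tree.search (fun c S v => (((cx + s.small.size + c : ℕ) : ℝ) - 1) * v ≤
    wx + s.small.size * s.τ + S) L 0 0) = P at *
  obtain ⟨⟨p, S⟩, Psteps⟩ := P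
  simp only [zero_add, Prod.mk.injEq] at hpv hpc ha hb
  obtain ⟨rfl, rfl⟩ := hpv
  have hLlen : a.length + b.length + cx = s.large.size + 1 := by
    have := congrArg Multiset.card hLe
    rw [Multiset.coe_card, hab, List.length_append, Multiset.card_add, ← h.large_eq,
      Multiset.coe_card, ← hLsz] at this
    cases light <;> simp [hcx] at this ⊢ <;> omega
  have hgt : ∀ v ∈ a ++ b, s.τ < v := by
    intro v hv
    have : v ∈ (L.wts : Multiset ℝ) := by rw [hab]; exact hv
    rw [hLe] at this
    rcases Multiset.mem_add.1 this with h1 | h1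
    · cases light with
      | true => simp at h1
      | false =>
        simp only [Bool.false_eq_true, if_false, Multiset.mem_singleton] at h1
        rw [h1]; exact hheavy rfl
    · exact (Multiset.mem_filter.1 h1).2
  have hτ0 := h.nonneg
  have hwx0 : 0 ≤ wx := by rw [hwx]; split_ifs <;> linarith
  have hTτ : 0 ≤ s.small.size * s.τ := by positivity
  have hsmall : 1 ≤ s.small.size → 0 < s.τ := fun h1 =>
    lt_of_le_of_ne hτ0 fun h2 => by have := h.small_eq_zero.2 h2.symm; omega
  have hs' := hLs
  rw [hab] at hs'
  generalize hτ' : (wx + s.small.size * s.τ + a.sum) /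
    (((cx + s.small.size + a.length : ℕ) : ℝ) - 1) = τ' at *
  obtain ⟨ht, hτ'0, hττ', hav, hbv, hmul⟩ := newThreshold_spec (c₀ := cx + s.small.size)
    (s₀ := wx + s.small.size * s.τ) (τ' := τ') hs' hτ0 hgt
    (by rw [List.length_append]; omega) (by linarith)
    (by
      intro h2
      cases light with
      | true => simp [hwx]; linarith
      | false =>
        have h1 : 1 ≤ s.small.size := by simp [hcx] at h2; omega
        have h3 := hsmall h1
        have : (0 : ℝ) < s.small.size := by exact_mod_cast h1
        simp only [hwx, Bool.false_eq_true, if_false, zero_add]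
        positivity)
    (by
      cases light with
      | true => simp [hcx, hwx]; linarith
      | false => simp [hcx, hwx]; linarith)
    ha hb hτ'.symm
  -- (|T| + |a|) τ' is the total adjusted weight of `x`, T and `a`, which by the hypotheses on a
  -- light item is at least (|T| + |a|) w.
  have hwτ' : light = true → x.weight ≤ τ' := by
    intro hl
    obtain ⟨l1, l2, l3⟩ := hlight hl
    subst hl
    have hsum : a.length * x.weight ≤ a.sum := by
      refine mul_length_le_sum fun v hv => l3 v ?_
      have : v ∈ (L.wts : Multiset ℝ) := by rw [hab]; exact List.mem_append_left _ hv
      rw [hLe, if_pos rfl, zero_add, ← h.large_eq] at this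
      exact this
    have l1' : (1 : ℝ) ≤ s.small.size := by exact_mod_cast l1
    simp only [hcx, hwx, if_true] at hmul
    push_cast at hmul
    have : (s.small.size + a.length : ℝ) * x.weight ≤ (s.small.size + a.length : ℝ) * τ' := by
      linarith
    exact le_of_mul_le_mul_left this (by positivity)
  have hupd : ∀ L' T : Tree, L'.Valid → T.Valid → L'.wts = b →
      T.wts.length + 1 = cx + s.small.size + a.length →
      Inv k (x.weight ::ₘ A) ⟨L', T, τ', b.head?⟩ := fun L' T v1 v2 v3 v4 =>
    h.update hfull hx (hab ▸ hLe) hs' hττ' hτ'0 hav hbv hwτ' ht hmul v1 v2 v3 v4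
  have hheight : ∀ t : Tree, t.Valid → t.wts.length ≤ k + 1 → t.height ≤ Tree.maxHeight N :=
    fun t hv hl => hv.height_le (by rw [hv.size_eq]; omega)
  have hcx1 : cx ≤ 1 := by rw [hcx]; split_ifs <;> omega
  have hh1 := hheight s.large h.large_valid (by omega)
  have hh2 := hheight s.small h.small_valid (by omega)
  have hh3 := hheight L hLv (by rw [hab, List.length_append]; omega)
  have hpc' : Psteps ≤ L.height + 1 := hpc
  unfold slowCost
  split_ifs with hd1 hd2
  · simp only [Timed.bind_val, Timed.bind_steps, Timed.pure_val, Timed.pure_steps]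
    obtain ⟨i1, i2, i3, i4, i5, i6, i7⟩ := Tree.splitAt_spec a.length hLv
    rw [hab, List.take_left] at i3
    rw [hab, List.drop_left] at i4
    obtain ⟨j1, j2, j3⟩ := Tree.concat_spec h.small_valid i1
    obtain ⟨f1, f2⟩ := Tree.firstWeight_spec _ i2
    refine ⟨?_, hττ', ?_⟩
    · rw [f1, i4]
      refine hupd _ _ i2 j1 i4 ?_
      rw [j2, i3, List.length_append, ← hTsz, hcx, if_pos hd1.1]; omega
    · omega
  · simp only [Timed.bind_val, Timed.bind_steps, Timed.pure_val, Timed.pure_steps]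
    obtain ⟨dc, a₂, b₂, hab₂, hdv, ha₂, hb₂⟩ := Tree.search_spec
      (fun c _ _ => ((cx + c : ℕ) : ℝ) * τ' - (wx + c * s.τ) < u * τ') h.small_valid 0 0
    rw [hdv]
    simp only [zero_add] at ha₂ ⊢
    -- If the search ran off the end of T, its test at the last small item would contradict the
    -- condition of this branch; if T is empty, the branch conditions alone are contradictory.
    have hlt : a₂.length < s.small.wts.length := by
      rw [hab₂, List.length_append]
      refine Nat.lt_add_of_pos_right (Nat.pos_of_ne_zero fun hb0 => ?_)
      have hb0' : b₂ = [] := List.length_eq_zero_iff.1 hb0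
      subst hb0'
      rw [List.append_nil] at hab₂
      rw [hTsz, hab₂] at hd2
      rcases List.eq_nil_or_concat' a₂ with rfl | ⟨a', v', ha'⟩
      · cases light with
        | true => simp [hcx, hwx] at hd1 hd2; linarith
        | false =>
          simp [hcx, hwx] at hd2
          nlinarith [mul_pos hu0 hτ'0]
      · have := ha₂ a' v' ha'
        linarith
    obtain ⟨e1, e2, e3⟩ := Tree.deleteAt_spec h.small_valid a₂.length
    have e2' : (Tree.deleteAt a₂.length s.small).val.wts.length + 1 = s.small.size := by
      rw [e2, List.length_append, List.length_take, List.length_drop, hTsz]; omega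
    obtain ⟨i1, i2, i3, i4, i5, i6, i7⟩ := Tree.splitAt_spec a.length hLv
    rw [hab, List.take_left] at i3
    rw [hab, List.drop_left] at i4
    obtain ⟨j1, j2, j3⟩ := Tree.concat_spec e1 i1
    obtain ⟨l1, l2, l3⟩ := appendLight_spec j1 light x
    obtain ⟨f1, f2⟩ := Tree.firstWeight_spec _ i2
    rw [← hcx, j2, i3, List.length_append] at l2
    refine ⟨?_, hττ', ?_⟩
    · rw [f1, i4]
      exact hupd _ _ i2 l1 i4 (by omega)
    · have hh4 := hheight _ e1 (by omega)
      have hh5 := hheight _ j1 (by rw [j2, i3, List.length_append]; omega)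
      omega
  · simp only [Timed.bind_val, Timed.bind_steps, Timed.pure_val, Timed.pure_steps]
    obtain ⟨dc, a₂, b₂, hab₂, hdv, ha₂, hb₂⟩ := Tree.search_spec
      (fun c S _ => cx + s.small.size + c ≤ cx + s.small.size + a.length ∧
        ((cx + s.small.size + c : ℕ) : ℝ) * τ' - (wx + s.small.size * s.τ + S) < u * τ') hLv 0 0
    rw [hdv]
    simp only [zero_add] at ha₂ ⊢
    -- With `a` empty, c₀ τ' - s₀ = τ' ≥ u τ', and the previous branch would have been taken.
    have hpos : 0 < a.length := by
      refine Nat.pos_of_ne_zero fun h0 => hd2 ?_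
      have h0' : a = [] := List.length_eq_zero_iff.1 h0
      subst h0'
      simp only [List.length_nil, add_zero, List.sum_nil] at hmul
      nlinarith
    -- After all t items the tested quantity equals τ', which is not below u τ' because u < 1; so
    -- the search stops before the end of `a`.
    have hlt : a₂.length < a.length := by
      rcases List.eq_nil_or_concat' a₂ with rfl | ⟨a', v', ha'⟩
      · exact hpos
      · obtain ⟨g1, g2⟩ := ha₂ a' v' ha'
        refine lt_of_le_of_ne (by omega) fun he => ?_
        have : a₂ = a := (List.append_inj (hab₂.symm.trans hab) he).1
        rw [this] at g2
        nlinarith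
    obtain ⟨e1, e2, e3⟩ := Tree.deleteAt_spec hLv a₂.length
    rw [hab] at e2
    have e2' : (Tree.deleteAt a₂.length L).val.wts =
        (a.take a₂.length ++ a.drop (a₂.length + 1)) ++ b := by
      rw [e2, List.take_append_of_le_length hlt.le, List.drop_append_of_le_length hlt,
        List.append_assoc]
    have e2l : (a.take a₂.length ++ a.drop (a₂.length + 1)).length = a.length - 1 := by
      rw [List.length_append, List.length_take, List.length_drop]; omega
    obtain ⟨i1, i2, i3, i4, i5, i6, i7⟩ := Tree.splitAt_spec (a.length - 1) e1
    rw [e2', ← e2l, List.take_left] at i3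
    rw [e2', ← e2l, List.drop_left] at i4
    rw [e2l] at i3 i4
    obtain ⟨j1, j2, j3⟩ := Tree.concat_spec h.small_valid i1
    obtain ⟨l1, l2, l3⟩ := appendLight_spec j1 light x
    obtain ⟨f1, f2⟩ := Tree.firstWeight_spec _ i2
    rw [← hcx, j2, i3, List.length_append, e2l] at l2
    refine ⟨?_, hττ', ?_⟩
    · rw [f1, i4]
      exact hupd _ _ i2 l1 i4 (by omega)
    · have hh4 := hheight _ e1 (by rw [e2', List.length_append, e2l]; omega)
      have hh5 := hheight _ j1 (by rw [j2, i3, List.length_append, e2l]; omega)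
      omega

end VarOpt

/-! ### Amortized cost of a round. -/

namespace VarOpt

theorem Inv.large_size_eq {k : ℕ} {A : Multiset ℝ} {s : State} (h : Inv k A s) :
    s.large.size = (A.filter (s.τ < ·)).card := by
  rw [← h.large_eq, Multiset.coe_card, h.large_valid.size_eq]

theorem filter_lt_le {A : Multiset ℝ} {τ τ' : ℝ} (h : τ ≤ τ') :
    A.filter (τ' < ·) ≤ A.filter (τ < ·) :=
  Multiset.monotone_filter_right A fun _ hv => h.trans_lt hv

theorem Inv.large_size_le_add_one {k : ℕ} {A : Multiset ℝ} {w : ℝ} {s s' : State}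
    (h : Inv k A s) (h' : Inv k (w ::ₘ A) s') (hτ : s.τ ≤ s'.τ) :
    s'.large.size ≤ s.large.size + 1 := by
  rw [h.large_size_eq, h'.large_size_eq]
  have h1 := Multiset.card_le_card (filter_lt_le (A := A) hτ)
  by_cases hw : s'.τ < w
  · rw [Multiset.filter_cons_of_pos (p := fun v => s'.τ < v) _ hw, Multiset.card_cons]; omega
  · rw [Multiset.filter_cons_of_neg (p := fun v => s'.τ < v) _ hw]; omega

/-- If no large item falls below the new threshold, then L and |T| are unchanged, and comparing
total weights before and after determines the new threshold: it is the tentative one of the fast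
path. -/
theorem Inv.large_size_lt_or {k : ℕ} {A : Multiset ℝ} {w : ℝ} {s s' : State}
    (h : Inv k A s) (h' : Inv k (w ::ₘ A) s') (hτ : s.τ ≤ s'.τ) (hfull : k ≤ A.card)
    (hw : w ≤ s'.τ) :
    s'.large.size + 1 ≤ s.large.size ∨ s'.large.size = s.large.size ∧
      s.small.size * s'.τ = w + s.small.size * s.τ ∧ ∀ v ∈ s.large.wts, s'.τ < v := by
  have hle := filter_lt_le (A := A) hτ
  have e := h'.large_eq
  rw [Multiset.filter_cons_of_neg _ (not_lt.2 hw)] at e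
  have hs := h.large_size_eq
  have hs' : s'.large.size = (A.filter (s'.τ < ·)).card := by
    rw [← e, Multiset.coe_card, h'.large_valid.size_eq]
  rcases (Multiset.card_le_card hle).lt_or_eq with hlt | heq
  · left; omega
  · right
    have hAA := Multiset.eq_of_le_of_card_le hle heq.ge
    rw [hAA, ← h.large_eq] at e
    have hc := h.card
    have hc' := h'.card
    rw [Multiset.card_cons] at hc'
    have hT : s'.small.size = s.small.size := by omega
    refine ⟨by omega, ?_, ?_⟩
    · have t := h.total
      have t' := h'.total
      have := congrArg Multiset.sum e
      rw [Multiset.sum_coe, Multiset.sum_coe] at this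
      rw [hT, this, Multiset.sum_cons] at t'
      linarith
    · intro v hv
      have : v ∈ (s'.large.wts : Multiset ℝ) := by rw [e]; exact hv
      exact h'.lt_of_mem this

theorem step_filling {k : ℕ} {A : Multiset ℝ} {s : State} (h : Inv k A s) (hfill : A.card < k)
    {x : Item} (hx : 0 < x.weight) (u : ℝ) {N : ℕ} (hN : A.card + 1 ≤ N) :
    Inv k (x.weight ::ₘ A) (step k s x u).val ∧
      (step k s x u).val.large.size = s.large.size + 1 ∧
      (step k s x u).steps ≤ 1 + slowCost N := by
  have hτ := h.filling hfill.le
  have hT := h.small_eq_zero.2 hτ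
  have hc := h.card
  obtain ⟨i1, i2, i3, i4⟩ := Tree.insertSorted_spec h.large_valid h.sorted x
  obtain ⟨f1, f2⟩ := Tree.firstWeight_spec _ i1
  have hlen := congrArg Multiset.card i3
  rw [Multiset.card_cons, Multiset.coe_card, Multiset.coe_card, ← i1.size_eq,
    ← h.large_valid.size_eq] at hlen
  unfold step
  simp only [Timed.bind_val, Timed.bind_steps, tick_steps]
  rw [if_pos (by omega)]
  simp only [Timed.bind_val, Timed.bind_steps, Timed.pure_val, Timed.pure_steps]
  refine ⟨⟨i1, h.small_valid, i2, ?_, ?_, ?_, h.nonneg, h.small_eq_zero, f1, ?_, fun _ => hτ⟩,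
    hlen, ?_⟩
  · rw [i3, h.large_eq, Multiset.filter_cons_of_pos]
    simpa [hτ] using hx
  · have := congrArg Multiset.sum i3
    rw [Multiset.sum_cons, Multiset.sum_coe, Multiset.sum_coe] at this
    dsimp only
    rw [this, Multiset.sum_cons, ← h.total]
    ring
  · dsimp only
    rw [hlen, Multiset.card_cons]; omega
  · intro v hv
    rcases Multiset.mem_cons.1 hv with rfl | hv
    · exact hx
    · exact h.pos v hv
  · have h1 := h.large_valid.height_le (N := N) (by omega)
    have h2 := i1.height_le (N := N) (by omega)
    unfold slowCost
    omega

/-- The potential is `slowCost N` times |L|. The factor 2 pays for the tree operations and for one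
possible new large item. For an item inserted into L, the event in the bound need not be that of its
being kept; it is used because its failure gives w ≤ τ'. -/
theorem step_full {k : ℕ} {A : Multiset ℝ} {s : State} (h : Inv k A s) (hk : 1 ≤ k)
    (hfull : k ≤ A.card) {x : Item} (hx : 0 < x.weight) {u : ℝ} (hu0 : 0 < u) (hu1 : u < 1)
    {N : ℕ} (hN : k + 1 ≤ N) :
    Inv k (x.weight ::ₘ A) (step k s x u).val ∧
      (step k s x u).steps + slowCost N * (step k s x u).val.large.size ≤
        1 + slowCost N * s.large.size + 2 * slowCost N *
          (if (step k s x u).val.τ - x.weight < u * (step k s x u).val.τ then 1 else 0) := by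
  have hc := h.card
  have hcard : s.large.size + s.small.size = k := by omega
  have hτ0 := h.nonneg
  have hpos : s.small.size ≠ 0 → 0 < s.τ := fun h1 =>
    lt_of_le_of_ne hτ0 fun h2 => h1 (h.small_eq_zero.2 h2.symm)
  -- The premise on `s'` says that a round that leaves L unchanged and sets the tentative threshold
  -- can reach the tree path only if it is included.
  have key : ∀ s' : State, Inv k (x.weight ::ₘ A) s' → s.τ ≤ s'.τ → ∀ c, c ≤ slowCost N →
      (s'.large.size = s.large.size → s.small.size * s'.τ = x.weight + s.small.size * s.τ →
        (∀ v ∈ s.large.wts, s'.τ < v) → s'.τ - x.weight < u * s'.τ) →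
      1 + c + slowCost N * s'.large.size ≤ 1 + slowCost N * s.large.size + 2 * slowCost N *
          (if s'.τ - x.weight < u * s'.τ then 1 else 0) := by
    intro s' h' hτ c hcN himp
    split_ifs with hinc
    · have := Nat.mul_le_mul_left (slowCost N) (h.large_size_le_add_one h' hτ)
      rw [mul_add] at this
      omega
    · have hw : x.weight ≤ s'.τ := by
        have : 0 ≤ u * s'.τ := mul_nonneg hu0.le (hτ0.trans hτ)
        linarith
      rcases h.large_size_lt_or h' hτ hfull hw with h1 | ⟨h1, h2, h3⟩
      · have := Nat.mul_le_mul_left (slowCost N) h1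
        rw [mul_add] at this
        omega
      · exact absurd (himp h1 h2 h3) hinc
  unfold step
  simp only [Timed.bind_val, Timed.bind_steps, tick_steps]
  rw [if_neg (by omega)]
  have hdiv : s.small.size ≠ 0 → ∀ y : ℝ,
      s.small.size * y = x.weight + s.small.size * s.τ →
      (x.weight + s.small.size * s.τ) / s.small.size = y := by
    intro h1 y hy
    rw [← hy]; field_simp
  generalize hτ₁ : (x.weight + s.small.size * s.τ) / (s.small.size : ℝ) = τ₁ at *
  have hτ₁' : s.small.size ≠ 0 → s.small.size * τ₁ = x.weight + s.small.size * s.τ := by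
    intro h1
    rw [← hτ₁]; field_simp
  by_cases c1 : s.small.size = 0 ∨ τ₁ ≤ x.weight ∨ ∃ v, s.minLarge = some v ∧ v ≤ τ₁
  · rw [if_pos c1]
    obtain ⟨i1, i2, i3⟩ := slowStep_spec h hk hfull hx hu0 hu1
      (light := decide (x.weight ≤ s.τ)) (N := N)
      (by
        intro hl
        have hl := of_decide_eq_true hl
        have h1 : s.small.size ≠ 0 := fun h1 => by
          have := h.small_eq_zero.1 h1; linarith
        refine ⟨Nat.one_le_iff_ne_zero.2 h1, ?_, fun v hv => hl.trans (h.lt_of_mem hv).le⟩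
        have := mul_le_mul_of_nonneg_left hl (Nat.cast_nonneg (α := ℝ) s.small.size)
        linarith)
      (fun hl => not_le.1 (of_decide_eq_false hl)) hN
    refine ⟨i1, key _ i1 i2 _ i3 ?_⟩
    intro h1 h2 h3
    have hτ' : 0 < (slowStep s x u (decide (x.weight ≤ s.τ))).val.τ := by
      refine lt_of_le_of_ne i1.nonneg fun h0 => ?_
      rw [← h0] at h2
      have : 0 ≤ s.small.size * s.τ := by positivity
      linarith
    have hsm : s.small.size ≠ 0 := fun h0 => by
      rw [h0] at h2; simp at h2; linarith
    have he := hdiv hsm _ h2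
    -- Of the three reasons for leaving the fast path, |T| = 0 and τ' ≥ w_ℓ contradict an unchanged
    -- L with the tentative threshold, and w ≥ τ' makes the round included since u τ' > 0.
    rcases c1 with c1 | c1 | ⟨v, c1, c1'⟩
    · exact absurd c1 hsm
    · rw [he] at c1
      have := mul_pos hu0 hτ'
      linarith
    · rw [h.minLarge_eq] at c1
      have := h3 v (List.mem_of_head? c1)
      linarith
  rw [if_neg c1]
  push Not at c1
  obtain ⟨c3, c4, c5⟩ := c1
  have hm := hτ₁' c3
  have hL : ∀ v ∈ s.large.wts, τ₁ < v := by
    intro v hv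
    have hp := h.sorted.pairwise
    cases hw : s.large.wts with
    | nil => rw [hw] at hv; simp at hv
    | cons y l =>
      rw [hw] at hv hp
      have := c5 y (by rw [h.minLarge_eq, hw]; rfl)
      rcases List.mem_cons.1 hv with rfl | hv
      · exact this
      · exact this.trans_le ((List.pairwise_cons.1 hp).1 v hv)
  by_cases c2 : u * τ₁ ≤ τ₁ - x.weight
  · rw [if_pos c2]
    have hsz : (0 : ℝ) < s.small.size := by exact_mod_cast Nat.pos_of_ne_zero c3
    have hle : s.τ ≤ τ₁ := by
      refine le_of_mul_le_mul_left ?_ hsz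
      linarith
    have hτ₁0 : 0 < τ₁ := (hpos c3).trans_le hle
    refine ⟨⟨h.large_valid, h.small_valid, h.sorted, ?_, ?_, ?_, hτ₁0.le, ?_, h.minLarge_eq, ?_, ?_⟩,
      ?_⟩
    · dsimp
      rw [Multiset.filter_cons_of_neg _ (not_lt.2 c4.le), h.large_eq]
      have : (A.filter (s.τ < ·)).filter (τ₁ < ·) = A.filter (τ₁ < ·) := by
        rw [Multiset.filter_filter]
        exact Multiset.filter_congr fun v _ => ⟨fun h => h.1, fun h => ⟨h, hle.trans_lt h⟩⟩
      rw [← this]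
      refine (Multiset.filter_eq_self.2 fun v hv => hL v ?_).symm
      rw [← h.large_eq] at hv
      exact hv
    · dsimp
      rw [hm, Multiset.sum_cons, ← h.total]; ring
    · dsimp
      rw [Multiset.card_cons]; omega
    · dsimp
      exact ⟨fun h1 => absurd h1 c3, fun h1 => absurd h1 hτ₁0.ne'⟩
    · intro v hv
      rcases Multiset.mem_cons.1 hv with rfl | hv
      · exact hx
      · exact h.pos v hv
    · intro hc
      rw [Multiset.card_cons] at hc; omega
    · simp
  · rw [if_neg c2]
    obtain ⟨i1, i2, i3⟩ := slowStep_spec h hk hfull hx hu0 hu1 (light := true) (N := N)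
      (by
        intro _
        refine ⟨Nat.one_le_iff_ne_zero.2 c3, ?_, ?_⟩
        · rw [← hm]
          exact mul_le_mul_of_nonneg_left c4.le (Nat.cast_nonneg _)
        · exact fun v hv => (c4.trans (hL v hv)).le)
      (by simp) hN
    refine ⟨i1, key _ i1 i2 _ i3 ?_⟩
    intro h1 h2 h3
    rw [← hdiv c3 _ h2]
    exact not_le.1 c2

/-! ### The threshold as a function of the prefix alone. -/

/-- `τ` is a threshold for `A`: the inclusion probabilities `min 1 (a / τ)` add up to `k`. -/
def IsThreshold (k : ℕ) (A : Multiset ℝ) (τ : ℝ) : Prop :=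
  0 < τ ∧ (A.map fun a => min 1 (a / τ)).sum = k

/-- Large items contribute 1 each. The others contribute their total weight divided by τ, which is
|T| by conservation of the total weight. -/
theorem Inv.isThreshold {k : ℕ} {A : Multiset ℝ} {s : State} (h : Inv k A s)
    (hA : k < A.card) : IsThreshold k A s.τ := by
  have hc := h.card
  have hτ : 0 < s.τ := by
    refine lt_of_le_of_ne h.nonneg fun h0 => ?_
    have h1 := h.small_eq_zero.2 h0.symm
    have h2 := h.large_size_eq
    rw [← h0, Multiset.filter_eq_self.2 h.pos] at h2
    omega
  refine ⟨hτ, ?_⟩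
  rw [← Multiset.filter_add_not (s.τ < ·) A, Multiset.map_add, Multiset.sum_add]
  have e1 : ((A.filter (s.τ < ·)).map fun a => min 1 (a / s.τ)).sum = s.large.size := by
    rw [Multiset.map_congr rfl (g := fun _ => (1 : ℝ)), Multiset.map_const', Multiset.sum_replicate,
      ← h.large_size_eq]
    · simp
    · intro a ha
      exact min_eq_left ((one_le_div hτ).2 (Multiset.mem_filter.1 ha).2.le)
  have e2 : ((A.filter (¬ s.τ < ·)).map fun a => min 1 (a / s.τ)).sum = s.small.size := by
    rw [Multiset.map_congr rfl (g := fun a => id a / s.τ), Multiset.sum_map_div, Multiset.map_id,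
      div_eq_iff hτ.ne']
    · have t := h.total
      rw [← Multiset.filter_add_not (s.τ < ·) A, Multiset.sum_add, ← h.large_eq,
        Multiset.sum_coe] at t
      linarith
    · intro a ha
      exact min_eq_right ((div_le_one hτ).2 (not_lt.1 (Multiset.mem_filter.1 ha).2))
  rw [e1, e2]
  norm_cast
  omega

/-- The sum is nonincreasing in τ, and strictly smaller at τ' > τ as soon as some a < τ'. If there
is no such a, the sum at τ' is the number of items, which exceeds k. -/
theorem IsThreshold.le {k : ℕ} {A : Multiset ℝ} {τ τ' : ℝ} (hA : k < A.card)
    (hpos : ∀ a ∈ A, 0 < a) (h : IsThreshold k A τ) (h' : IsThreshold k A τ') : τ' ≤ τ := by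
  by_contra! hlt
  have hmono : ∀ a ∈ A, min 1 (a / τ') ≤ min 1 (a / τ) := fun a ha =>
    min_le_min_left _ (div_le_div_of_nonneg_left (hpos a ha).le h.1 hlt.le)
  by_cases hall : ∀ a ∈ A, τ' ≤ a
  · have := h'.2
    rw [Multiset.map_congr rfl (g := fun _ => (1 : ℝ)), Multiset.map_const',
      Multiset.sum_replicate] at this
    · simp at this; omega
    · intro a ha
      exact min_eq_left ((one_le_div h'.1).2 (hall a ha))
  · push Not at hall
    obtain ⟨a, ha, hlta⟩ := hall
    have : (A.map fun a => min 1 (a / τ')).sum < (A.map fun a => min 1 (a / τ)).sum := by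
      refine Multiset.sum_lt_sum hmono ⟨a, ha, ?_⟩
      rw [min_eq_right ((div_lt_one h'.1).2 hlta).le]
      exact lt_min ((div_lt_one h'.1).2 hlta) (div_lt_div_of_pos_left (hpos a ha) h.1 hlt)
    rw [h.2, h'.2] at this
    exact lt_irrefl _ this

theorem IsThreshold.unique {k : ℕ} {A : Multiset ℝ} {τ τ' : ℝ} (hA : k < A.card)
    (hpos : ∀ a ∈ A, 0 < a) (h : IsThreshold k A τ) (h' : IsThreshold k A τ') : τ' = τ :=
  le_antisymm (h.le hA hpos h') (h'.le hA hpos h)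

open Classical in
/-- The threshold for `A`, if there is one. -/
def threshold (k : ℕ) (A : Multiset ℝ) : ℝ :=
  if h : ∃ τ, IsThreshold k A τ then h.choose else 1

theorem Inv.threshold_eq {k : ℕ} {A : Multiset ℝ} {s : State} (h : Inv k A s)
    (hA : k < A.card) : threshold k A = s.τ := by
  have hex : ∃ τ, IsThreshold k A τ := ⟨_, h.isThreshold hA⟩
  rw [threshold, dif_pos hex]
  exact (h.isThreshold hA).unique hA h.pos hex.choose_spec

/-- The random number `u` puts the last item, of weight `w`, of the prefix `A` into the reservoir. -/
def Included (k : ℕ) (A : Multiset ℝ) (w u : ℝ) : Prop :=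
  A.card ≤ k ∨ threshold k A - w < u * threshold k A

open Classical in
theorem step_spec {k : ℕ} {A : Multiset ℝ} {s : State} (h : Inv k A s) (hk : 1 ≤ k)
    {x : Item} (hx : 0 < x.weight) {u : ℝ} (hu0 : 0 < u) (hu1 : u < 1)
    {N : ℕ} (hN : min k (A.card + 1) + 1 ≤ N) :
    Inv k (x.weight ::ₘ A) (step k s x u).val ∧
      (step k s x u).steps + slowCost N * (step k s x u).val.large.size ≤
        1 + slowCost N * s.large.size + 2 * slowCost N *
          (if Included k (x.weight ::ₘ A) x.weight u then 1 else 0) := by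
  rcases Nat.lt_or_ge A.card k with hlt | hge
  · obtain ⟨i1, i2, i3⟩ := step_filling h hlt hx u (N := N) (by omega)
    refine ⟨i1, ?_⟩
    -- A filling round counts as included, which pays for the insertion and for the new large item.
    have hinc : Included k (x.weight ::ₘ A) x.weight u :=
      Or.inl (by rw [Multiset.card_cons]; omega)
    rw [if_pos hinc, i2, mul_add]
    omega
  · obtain ⟨i1, i2⟩ := step_full h hk hge hx hu0 hu1 (N := N) (by omega)
    refine ⟨i1, i2.trans ?_⟩
    have hcard : k < (x.weight ::ₘ A).card := by rw [Multiset.card_cons]; omega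
    rw [← i1.threshold_eq hcard]
    gcongr
    split_ifs with h1 h2
    · exact le_rfl
    · exact absurd (Or.inr h1) h2
    · exact Nat.zero_le _
    · exact le_rfl

/-- The multiset of the weights of the first `i + 1` items. -/
def prefixWeights {n : ℕ} (w : Fin n → ℝ) (i : Fin n) : Multiset ℝ :=
  (Finset.Iic i).val.map w

open Classical in
-- The potential telescopes over the rounds and its final value is dropped. `A` holds the items that
-- arrived before this stretch of the stream.
theorem run_steps_le {k n : ℕ} (hk : 1 ≤ k) {N : ℕ} (x : Fin n → Item) (u : Fin n → ℝ)
    (hx : ∀ i, 0 < (x i).weight) (hu : ∀ i, u i ∈ Set.Ioo (0 : ℝ) 1) {A : Multiset ℝ} {s : State}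
    (h : Inv k A s) (hN : min k (A.card + n) + 1 ≤ N) :
    (run k s (List.ofFn fun i => (x i, u i))).steps ≤ n + slowCost N * s.large.size +
      2 * slowCost N * ∑ i, if Included k (prefixWeights (fun i => (x i).weight) i + A)
        (x i).weight (u i) then 1 else 0 := by
  induction n generalizing A s with
  | zero => simp [run]
  | succ n ih =>
    rw [List.ofFn_succ, run]
    simp only [Timed.bind_steps]
    obtain ⟨i1, i2⟩ := step_spec h hk (hx 0) (hu 0).1 (hu 0).2 (N := N) (by omega)
    have := ih (fun i => x i.succ) (fun i => u i.succ) (fun i => hx _) (fun i => hu _) i1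
      (by rw [Multiset.card_cons]; omega)
    rw [Fin.sum_univ_succ, mul_add]
    have e0 : prefixWeights (fun i => (x i).weight) 0 + A = (x 0).weight ::ₘ A := by
      have : Finset.Iic (0 : Fin (n + 1)) = {0} := by
        ext i; simp
      simp [prefixWeights, this]
    have es : ∀ i : Fin n, prefixWeights (fun i => (x i).weight) i.succ + A =
        prefixWeights (fun i : Fin n => (x i.succ).weight) i + (x 0).weight ::ₘ A := by
      intro i
      have : Finset.Iic i.succ = Finset.cons 0 ((Finset.Iic i).map (Fin.succEmb n)) (by simp) := by
        ext j
        refine Fin.cases ?_ (fun j => ?_) j <;> simp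
      rw [prefixWeights, this, Finset.cons_val, Finset.map_val, Multiset.map_cons, Multiset.map_map,
        Multiset.cons_add, Multiset.add_cons]
      rfl
    rw [e0]
    simp only [es]
    omega

open Classical in
theorem time_le {k n : ℕ} (hk : 1 ≤ k) (w : Fin n → ℝ) (hw : ∀ i, 0 < w i)
    (σ : Equiv.Perm (Fin n)) (u : Fin n → ℝ) (hu : ∀ i, u i ∈ Set.Ioo (0 : ℝ) 1) :
    time k w σ u ≤ n + 2 * slowCost (min k n + 1) *
      ∑ i, if Included k (prefixWeights (w ∘ σ) i) (w (σ i)) (u i) then 1 else 0 := by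
  have := run_steps_le hk (N := min k n + 1) (fun i => (⟨(σ i : ℕ), w (σ i)⟩ : Item)) u
    (fun i => hw _) hu (Inv.init k) (by simp)
  rw [show State.init.large.size = 0 from rfl, mul_zero, add_zero] at this
  simp only [add_zero] at this
  exact this

end VarOpt

/-! ### Measurability of the running time in the random numbers. -/

namespace VarOpt

/-- A function with countably many values and measurable fibres. -/
def CountablyValued {Ω β : Type} [MeasurableSpace Ω] (f : Ω → β) : Prop :=
  (Set.range f).Countable ∧ ∀ y, MeasurableSet (f ⁻¹' {y})

namespace CountablyValued

variable {Ω Ω' β γ : Type} [MeasurableSpace Ω] [MeasurableSpace Ω']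

theorem const (b : β) : CountablyValued fun _ : Ω => b := by
  refine ⟨(Set.countable_singleton b).mono ?_, fun y => MeasurableSet.const (b ∈ ({y} : Set β))⟩
  rintro _ ⟨ω, rfl⟩
  rfl

/-- A countable-valued choice among countably valued functions is countably valued. -/
theorem dcomp {f : Ω → β} {F : β → Ω → γ} (hf : CountablyValued f)
    (hF : ∀ y, CountablyValued (F y)) : CountablyValued fun ω => F (f ω) ω := by
  refine ⟨(hf.1.biUnion fun y _ => (hF y).1).mono ?_, fun z => ?_⟩
  · rintro _ ⟨ω, rfl⟩
    exact Set.mem_biUnion (Set.mem_range_self ω) (Set.mem_range_self ω)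
  · have : (fun ω => F (f ω) ω) ⁻¹' {z} = ⋃ y ∈ Set.range f, f ⁻¹' {y} ∩ F y ⁻¹' {z} := by
      ext ω
      simp only [Set.mem_iUnion, exists_prop, Set.mem_preimage, Set.mem_singleton_iff,
        Set.mem_inter_iff]
      exact ⟨fun h => ⟨f ω, Set.mem_range_self ω, rfl, h⟩, fun ⟨y, _, hy, h⟩ => by rw [hy, h]⟩
    rw [this]
    exact MeasurableSet.biUnion hf.1 fun y _ => (hf.2 y).inter ((hF y).2 z)

theorem map {f : Ω → β} (hf : CountablyValued f) (g : β → γ) :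
    CountablyValued fun ω => g (f ω) :=
  hf.dcomp (F := fun y _ => g y) fun y => const (g y)

theorem comp_measurable {f : Ω → β} (hf : CountablyValued f) {g : Ω' → Ω} (hg : Measurable g) :
    CountablyValued fun ω => f (g ω) :=
  ⟨hf.1.mono (Set.range_comp_subset_range g f), fun y => hg (hf.2 y)⟩

theorem ite {p : Ω → Prop} [∀ ω, Decidable (p ω)] (hp : MeasurableSet {ω | p ω}) {f g : Ω → β}
    (hf : CountablyValued f) (hg : CountablyValued g) :
    CountablyValued fun ω => if p ω then f ω else g ω := by
  have hd : CountablyValued fun ω => decide (p ω) := by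
    refine ⟨Set.to_countable _, fun y => ?_⟩
    cases y with
    | true => convert hp using 1; ext ω; simp
    | false => convert hp.compl using 1; ext ω; simp
  have := hd.dcomp (F := fun c ω => if c = true then f ω else g ω) fun c => by
    cases c with
    | true => simpa using hf
    | false => simpa using hg
  simpa using this

/-- Trees and states carry no σ-algebra here. Since the random numbers act only through comparisons,
each intermediate value takes countably many values and can be fixed while the continuation is
treated. -/
theorem bind {x : Ω → Timed β} (hx : CountablyValued x) {g : β → Ω → Timed γ}
    (hg : ∀ a, CountablyValued (g a)) : CountablyValued fun ω => x ω >>= fun a => g a ω :=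
  hx.dcomp (F := fun y ω => y >>= fun a => g a ω) fun y =>
    (hg y.val).map fun z => (⟨z.val, y.steps + z.steps⟩ : Timed γ)

end CountablyValued

variable {Ω : Type} [MeasurableSpace Ω]

theorem Tree.countablyValued_search (goRight : Ω → ℕ → ℝ → ℝ → Prop)
    [∀ ω c s v, Decidable (goRight ω c s v)]
    (h : ∀ c s v, MeasurableSet {ω | goRight ω c s v}) (t : Tree) (c₀ : ℕ) (s₀ : ℝ) :
    CountablyValued fun ω => Tree.search (goRight ω) t c₀ s₀ := by
  induction t generalizing c₀ s₀ with
  | leaf => exact CountablyValued.const _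
  | node _ _ _ l x r ihl ihr =>
    simp only [Tree.search]
    exact (CountablyValued.const _).bind fun _ => (ihr _ _).ite (h _ _ _) (ihl _ _)

theorem measurableSet_const_and {a : Prop} {p : Ω → Prop} (hp : MeasurableSet {ω | p ω}) :
    MeasurableSet {ω | a ∧ p ω} :=
  (MeasurableSet.const a).inter hp

theorem countablyValued_slowStepTail (s : State) (x : Item) (light : Bool) (L : Tree) :
    CountablyValued fun u : ℝ => slowStepTail s x u light L := by
  unfold slowStepTail
  refine (CountablyValued.const _).bind fun p => ?_
  refine CountablyValued.ite ?_ (CountablyValued.const _) (CountablyValued.ite ?_ ?_ ?_)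
  · refine measurableSet_const_and ?_
    exact measurableSet_le (by fun_prop) (by fun_prop)
  · exact measurableSet_le (by fun_prop) (by fun_prop)
  · refine (Tree.countablyValued_search _ (fun c S v => ?_) _ _ _).bind
      fun d => CountablyValued.const _
    exact measurableSet_lt (by fun_prop) (by fun_prop)
  · refine (Tree.countablyValued_search _ (fun c S v => ?_) _ _ _).bind
      fun d => CountablyValued.const _
    refine measurableSet_const_and ?_
    exact measurableSet_lt (by fun_prop) (by fun_prop)

theorem countablyValued_slowStep (s : State) (x : Item) (light : Bool) :
    CountablyValued fun u : ℝ => slowStep s x u light := by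
  simp only [slowStep_eq]
  exact (CountablyValued.const _).bind fun _ => (CountablyValued.const _).bind fun L =>
    countablyValued_slowStepTail s x light L

theorem countablyValued_step (k : ℕ) (s : State) (x : Item) :
    CountablyValued fun u : ℝ => step k s x u := by
  unfold step
  refine (CountablyValued.const _).bind fun _ => ?_
  refine CountablyValued.ite (MeasurableSet.const _) (CountablyValued.const _) ?_
  refine CountablyValued.ite (MeasurableSet.const _) (countablyValued_slowStep _ _ _) ?_
  exact CountablyValued.ite (measurableSet_le (by fun_prop) (by fun_prop))
    (CountablyValued.const _) (countablyValued_slowStep _ _ _)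

theorem countablyValued_run (k : ℕ) {n : ℕ} (x : Fin n → Item) (u : Fin n → Ω → ℝ)
    (hu : ∀ i, Measurable (u i)) (s : State) :
    CountablyValued fun ω => run k s (List.ofFn fun i => (x i, u i ω)) := by
  induction n generalizing s with
  | zero => simpa [run] using CountablyValued.const _
  | succ n ih =>
    simp only [List.ofFn_succ, run]
    exact ((countablyValued_step k s (x 0)).comp_measurable (hu 0)).bind fun s' =>
      ih (fun i => x i.succ) (fun i => u i.succ) (fun i => hu _) s'

theorem measurable_time (k : ℕ) {n : ℕ} (w : Fin n → ℝ) (σ : Equiv.Perm (Fin n)) :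
    Measurable fun u => time k w σ u :=
  measurable_to_countable' ((countablyValued_run k (fun i => (⟨(σ i : ℕ), w (σ i)⟩ : Item))
    (fun i (u : Fin n → ℝ) => u i) (fun i => measurable_pi_apply i) State.init).map
      fun s => s.steps).2

end VarOpt

/-! ### Inclusion probabilities and the expected time. -/

namespace VarOpt

open MeasureTheory

/-- The algorithm itself, run with an arbitrary admissible random number, shows that every prefix
with more than k items has a threshold. -/
theorem exists_inv {k : ℕ} (hk : 1 ≤ k) (A : Multiset ℝ) (hA : ∀ a ∈ A, 0 < a) :
    ∃ s, Inv k A s := by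
  induction A using Multiset.induction with
  | empty => exact ⟨_, Inv.init k⟩
  | cons a A ih =>
    obtain ⟨s, hs⟩ := ih fun b hb => hA b (Multiset.mem_cons_of_mem hb)
    exact ⟨_, (step_spec hs hk (x := ⟨0, a⟩) (hA a (Multiset.mem_cons_self a A)) (u := 1 / 2)
      (by norm_num) (by norm_num) le_rfl).1⟩

theorem threshold_pos (k : ℕ) (A : Multiset ℝ) : 0 < threshold k A := by
  unfold threshold
  split_ifs with h
  · exact h.choose_spec.1
  · exact one_pos

open Classical in
/-- The probability that the last item, of weight `w`, of the prefix `A` is included. -/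
def inclProb (k : ℕ) (A : Multiset ℝ) (w : ℝ) : ℝ :=
  if A.card ≤ k then 1 else min 1 (w / threshold k A)

theorem inclProb_le_one (k : ℕ) (A : Multiset ℝ) (w : ℝ) : inclProb k A w ≤ 1 := by
  unfold inclProb
  split_ifs
  · exact le_rfl
  · exact min_le_left _ _

theorem sum_inclProb_le {k : ℕ} (hk : 1 ≤ k) {A : Multiset ℝ} (hA : ∀ a ∈ A, 0 < a) :
    (A.map (inclProb k A)).sum ≤ k := by
  by_cases h : A.card ≤ k
  · have : inclProb k A = fun _ => 1 := by
      ext w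
      rw [inclProb, if_pos h]
    rw [this, Multiset.map_const', Multiset.sum_replicate, nsmul_eq_mul, mul_one]
    exact_mod_cast h
  · obtain ⟨s, hs⟩ := exists_inv hk A hA
    have : inclProb k A = fun w => min 1 (w / s.τ) := by
      ext w
      rw [inclProb, if_neg h, hs.threshold_eq (not_le.1 h)]
    rw [this]
    exact (hs.isThreshold (not_le.1 h)).2.le

instance : IsProbabilityMeasure (volume.restrict (Set.Ioo (0 : ℝ) 1)) :=
  ⟨by simp⟩

instance (n : ℕ) : IsProbabilityMeasure (uniformNumbers n) := by
  unfold uniformNumbers; infer_instance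

theorem measurePreserving_eval_uniformNumbers {n : ℕ} (i : Fin n) :
    MeasurePreserving (fun u : Fin n → ℝ => u i) (uniformNumbers n)
      (volume.restrict (Set.Ioo (0 : ℝ) 1)) :=
  measurePreserving_eval _ i

theorem ae_mem_Ioo (n : ℕ) : ∀ᵐ u ∂uniformNumbers n, ∀ i, u i ∈ Set.Ioo (0 : ℝ) 1 := by
  rw [ae_all_iff]
  intro i
  exact (measurePreserving_eval_uniformNumbers i).quasiMeasurePreserving.ae
    (ae_restrict_mem measurableSet_Ioo)

theorem measurableSet_included (k : ℕ) (A : Multiset ℝ) (w : ℝ) :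
    MeasurableSet {v | Included k A w v} := by
  have h : MeasurableSet {v | threshold k A - w < v * threshold k A} :=
    measurableSet_lt (by fun_prop) (by fun_prop)
  exact (MeasurableSet.const (A.card ≤ k)).union h

/-- Beyond the filling phase, the included values of (0, 1) lie above 1 - w/τ. -/
theorem measureReal_included_le (k : ℕ) (A : Multiset ℝ) {w : ℝ} (hw : 0 < w) :
    (volume.restrict (Set.Ioo (0 : ℝ) 1)).real {v | Included k A w v} ≤ inclProb k A w := by
  unfold inclProb
  split_ifs with h
  · exact measureReal_le_one
  · refine le_min measureReal_le_one ?_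
    have hτ := threshold_pos k A
    have hsub : {v | Included k A w v} ∩ Set.Ioo (0 : ℝ) 1 ⊆ Set.Ioo (1 - w / threshold k A) 1 := by
      rintro v ⟨hv, hv'⟩
      have hv := hv.resolve_left h
      refine ⟨?_, hv'.2⟩
      have : (1 - w / threshold k A) * threshold k A < v * threshold k A := by
        rw [sub_mul, div_mul_cancel₀ _ hτ.ne', one_mul]
        exact hv
      exact lt_of_mul_lt_mul_right this hτ.le
    rw [measureReal_restrict_apply (measurableSet_included k A w)]
    refine (measureReal_mono hsub (by simp)).trans ?_
    rw [Real.volume_real_Ioo_of_le (by linarith [div_pos hw hτ])]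
    linarith

open Classical in
theorem integral_included {n : ℕ} (k : ℕ) (A : Multiset ℝ) {w : ℝ} (hw : 0 < w) (i : Fin n) :
    Integrable (fun u : Fin n → ℝ => if Included k A w (u i) then (1 : ℝ) else 0)
      (uniformNumbers n) ∧
    ∫ u, (if Included k A w (u i) then (1 : ℝ) else 0) ∂uniformNumbers n ≤ inclProb k A w := by
  have hm := measurableSet_included k A w
  have e : (fun u : Fin n → ℝ => if Included k A w (u i) then (1 : ℝ) else 0) =
      Set.indicator ((fun u : Fin n → ℝ => u i) ⁻¹' {v | Included k A w v}) 1 := by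
    ext u
    simp [Set.indicator]
  have hm' := hm.preimage (measurable_pi_apply (X := fun _ : Fin n => ℝ) i)
  rw [e]
  refine ⟨(integrable_const 1).indicator hm', ?_⟩
  rw [integral_indicator_one hm',
    (measurePreserving_eval_uniformNumbers i).measureReal_preimage hm.nullMeasurableSet]
  exact measureReal_included_le k A hw

theorem integral_time_le {k n : ℕ} (hk : 1 ≤ k) (w : Fin n → ℝ) (hw : ∀ i, 0 < w i)
    (σ : Equiv.Perm (Fin n)) :
    Integrable (fun u => (time k w σ u : ℝ)) (uniformNumbers n) ∧
    ∫ u, (time k w σ u : ℝ) ∂uniformNumbers n ≤ n + 2 * slowCost (min k n + 1) *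
      ∑ i, inclProb k (prefixWeights (w ∘ σ) i) (w (σ i)) := by
  classical
  have hle : ∀ᵐ u ∂uniformNumbers n, (time k w σ u : ℝ) ≤
      (n : ℝ) + 2 * slowCost (min k n + 1) *
        ∑ i, if Included k (prefixWeights (w ∘ σ) i) (w (σ i)) (u i) then 1 else 0 := by
    filter_upwards [ae_mem_Ioo n] with u hu
    exact_mod_cast time_le hk w hw σ u hu
  have hint := fun i : Fin n =>
    integral_included k (prefixWeights (w ∘ σ) i) (hw (σ i)) i
  have hsum : Integrable (fun u : Fin n → ℝ => ∑ i,
      if Included k (prefixWeights (w ∘ σ) i) (w (σ i)) (u i) then (1 : ℝ) else 0)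
      (uniformNumbers n) := integrable_finsetSum _ fun i _ => (hint i).1
  have hbound := (integrable_const (μ := uniformNumbers n) (n : ℝ)).add
    (hsum.const_mul (2 * slowCost (min k n + 1) : ℝ))
  have htime : Integrable (fun u => (time k w σ u : ℝ)) (uniformNumbers n) := by
    refine hbound.mono' ?_ ?_
    · exact (measurable_from_nat.comp (measurable_time k w σ)).aestronglyMeasurable
    · filter_upwards [hle] with u hu
      rw [Real.norm_of_nonneg (Nat.cast_nonneg _)]
      exact hu
  refine ⟨htime, (integral_mono_ae htime hbound hle).trans ?_⟩
  rw [integral_add' (integrable_const _) (hsum.const_mul _), integral_const_mul,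
    integral_finsetSum _ fun i _ => (hint i).1]
  simp only [integral_const, probReal_univ, one_smul]
  gcongr with i
  exact (hint i).2

theorem prefixWeights_comp_swap {n : ℕ} (w : Fin n → ℝ) {m i : Fin n} (hm : m ≤ i) :
    prefixWeights (w ∘ Equiv.swap m i) i = prefixWeights w i := by
  have : (Finset.Iic i).map (Equiv.swap m i).toEmbedding = Finset.Iic i := by
    refine Finset.eq_of_subset_of_card_le ?_ (by rw [Finset.card_map])
    intro j hj
    obtain ⟨l, hl, rfl⟩ := Finset.mem_map.1 hj
    rw [Finset.mem_Iic] at hl ⊢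
    rw [Equiv.coe_toEmbedding, Equiv.swap_apply_def]
    split_ifs <;> first | exact le_rfl | exact hm | exact hl
  conv_rhs => rw [prefixWeights, ← this]
  rw [Finset.map_val, Multiset.map_map]
  rfl

/-- Composing σ with the swap of positions m ≤ i permutes all orders and keeps the prefix multiset,
so each of the i + 1 prefix positions gives the same sum. For a fixed order the inclusion
probabilities over the prefix add up to at most k. -/
theorem sum_perm_inclProb_le {k n : ℕ} (hk : 1 ≤ k) (w : Fin n → ℝ) (hw : ∀ i, 0 < w i)
    (i : Fin n) :
    ∑ σ : Equiv.Perm (Fin n), inclProb k (prefixWeights (w ∘ σ) i) (w (σ i)) ≤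
      n.factorial * min 1 ((k : ℝ) / ((i : ℕ) + 1)) := by
  have hcard : ((Fintype.card (Equiv.Perm (Fin n)) : ℕ) : ℝ) = n.factorial := by
    rw [Fintype.card_perm, Fintype.card_fin]
  rw [mul_min_of_nonneg _ _ (Nat.cast_nonneg _)]
  refine le_min ?_ ?_
  · refine (Finset.sum_le_sum fun σ _ => inclProb_le_one k _ _).trans ?_
    simp [← hcard]
  · have hswap : ∀ m ∈ Finset.Iic i,
        ∑ σ : Equiv.Perm (Fin n), inclProb k (prefixWeights (w ∘ σ) i) (w (σ m)) =
        ∑ σ : Equiv.Perm (Fin n), inclProb k (prefixWeights (w ∘ σ) i) (w (σ i)) := by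
      intro m hm
      refine (Fintype.sum_equiv (Equiv.mulRight (Equiv.swap m i)) _ _ fun σ => ?_).symm
      have h1 : w ∘ (σ * Equiv.swap m i : Equiv.Perm (Fin n)) = (w ∘ σ) ∘ Equiv.swap m i := rfl
      rw [Equiv.coe_mulRight, h1, prefixWeights_comp_swap _ (Finset.mem_Iic.1 hm),
        Equiv.Perm.mul_apply, Equiv.swap_apply_left]
    have hsum := Finset.sum_congr rfl hswap
    rw [Finset.sum_const, Fin.card_Iic, nsmul_eq_mul, Finset.sum_comm] at hsum
    have hle : ∑ σ : Equiv.Perm (Fin n), ∑ m ∈ Finset.Iic i,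
        inclProb k (prefixWeights (w ∘ σ) i) (w (σ m)) ≤ n.factorial * k := by
      rw [← hcard, ← nsmul_eq_mul, ← Finset.card_univ]
      refine Finset.sum_le_card_nsmul _ _ _ fun σ _ => ?_
      have := sum_inclProb_le hk (A := prefixWeights (w ∘ σ) i) (by
        intro a ha
        obtain ⟨j, -, rfl⟩ := Multiset.mem_map.1 ha
        exact hw _)
      conv_lhs at this => arg 1; arg 2; rw [prefixWeights]
      rw [Multiset.map_map] at this
      exact this
    rw [hsum] at hle
    rw [mul_div_assoc', le_div_iff₀ (by positivity), mul_comm]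
    push_cast at hle
    exact hle

theorem expectedTime_le {k n : ℕ} (hk : 1 ≤ k) (w : Fin n → ℝ) (hw : ∀ i, 0 < w i) :
    expectedTime k w ≤ n + 2 * slowCost (min k n + 1) *
      ∑ i : Fin n, min 1 ((k : ℝ) / ((i : ℕ) + 1)) := by
  have hfac : (0 : ℝ) < n.factorial := by exact_mod_cast n.factorial_pos
  rw [expectedTime, div_le_iff₀ hfac]
  refine (Finset.sum_le_sum fun σ _ => (integral_time_le hk w hw σ).2).trans ?_
  rw [Finset.sum_add_distrib, ← Finset.mul_sum, Finset.sum_comm, Finset.sum_const,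
    Finset.card_univ, Fintype.card_perm, Fintype.card_fin, nsmul_eq_mul, add_mul,
    mul_comm (n.factorial : ℝ), mul_assoc _ (∑ _, _), Finset.sum_mul]
  gcongr with i
  rw [mul_comm]
  exact sum_perm_inclProb_le hk w hw i

theorem sum_min_le_natCast (k n : ℕ) :
    ∑ i : Fin n, min 1 ((k : ℝ) / ((i : ℕ) + 1)) ≤ n := by
  refine (Finset.sum_le_sum fun i _ => min_le_left _ _).trans ?_
  simp

theorem sum_min_le_mul_log (k n : ℕ) :
    ∑ i : Fin n, min 1 ((k : ℝ) / ((i : ℕ) + 1)) ≤ k * (1 + Real.log n) := by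
  refine (Finset.sum_le_sum fun i _ => min_le_right _ _).trans ?_
  have h := harmonic_le_one_add_log n
  rw [harmonic] at h
  push_cast at h
  rw [← Fin.sum_univ_eq_sum_range (fun i => ((i : ℝ) + 1)⁻¹)] at h
  simp only [div_eq_mul_inv]
  rw [← Finset.mul_sum]
  gcongr

/-- The relevant number of items plus one is at most 4k, which adds 2 to the binary logarithm; the
factor 2 bounds 1/log 2. -/
theorem slowCost_le {k n : ℕ} (hk : 1 ≤ k) :
    (slowCost (min k n + 1) : ℝ) ≤ 300 + 200 * Real.log k := by
  have h1 : Nat.log 2 (min k n + 1 + 1) ≤ Nat.log 2 k + 2 := by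
    have : min k n + 1 + 1 ≤ k * 2 * 2 := by omega
    refine (Nat.log_mono_right this).trans ?_
    rw [Nat.log_mul_base (by norm_num) (by omega), Nat.log_mul_base (by norm_num) (by omega)]
  have h2 : (Nat.log 2 k : ℝ) ≤ 2 * Real.log k := by
    have h3 : ((2 : ℝ)) ^ Nat.log 2 k ≤ k := by
      exact_mod_cast Nat.pow_log_le_self 2 (by omega)
    have h4 := Real.log_le_log (by positivity) h3
    rw [Real.log_pow] at h4
    have h5 := Real.log_two_gt_d9
    have h6 : (0 : ℝ) ≤ Nat.log 2 k := Nat.cast_nonneg _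
    nlinarith
  have h3 : (slowCost (min k n + 1) : ℝ) ≤ 100 * (Nat.log 2 k + 2) + 100 := by
    unfold slowCost Tree.maxHeight
    exact_mod_cast (by omega)
  linarith

end VarOpt

end

/-- Integrability is part of the conclusion because the Bochner integral of a nonintegrable function
is 0, which would make the bound empty. -/
theorem mainTheorem8 :
    ∃ C : ℝ, ∀ (k n : ℕ) (w : Fin n → ℝ), 1 ≤ k → (∀ i, 0 < w i) →
      (∀ σ : Equiv.Perm (Fin n), MeasureTheory.Integrable
        (fun u : Fin n → ℝ => (VarOpt.time k w σ u : ℝ)) (VarOpt.uniformNumbers n)) ∧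
      VarOpt.expectedTime k w ≤ C * ((n : ℝ) + (k : ℝ) * Real.log k * Real.log n) := by
  -- With M the expected number of included rounds as bounded above, the time is at most n + (600 +
  -- 400 log k) M. The bound M ≤ n serves the constant term, and M ≤ k(1 + log n) ≤ 3k log n the
  -- logarithmic one, giving 400 · 3 = 1200.
  refine ⟨1200, fun k n w hk hw => ⟨fun σ => (VarOpt.integral_time_le hk w hw σ).1,
    (VarOpt.expectedTime_le hk w hw).trans ?_⟩⟩
  have hM := VarOpt.sum_min_le_natCast k n
  have hlogk : 0 ≤ Real.log k := Real.log_natCast_nonneg k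
  rcases Nat.lt_or_ge n 2 with hn | hn
  · interval_cases n
    · simp
    -- For n = 1 the right side has no log k, so it matters that the trees are bounded by min k n
    -- and not only by k.
    · have h1 : VarOpt.slowCost (min k 1 + 1) = 200 := by
        rw [min_eq_right hk, VarOpt.slowCost, VarOpt.Tree.maxHeight]
        have : Nat.log 2 (1 + 1 + 1) = 1 := by decide
        rw [this]
      rw [h1]
      simp only [Nat.cast_one, Real.log_one, mul_zero, add_zero, mul_one] at hM ⊢
      push_cast
      linarith
  · have hM' := VarOpt.sum_min_le_mul_log k n
    have hK := VarOpt.slowCost_le (n := n) hk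
    set M := ∑ i : Fin n, min 1 ((k : ℝ) / ((i : ℕ) + 1)) with hMdef
    have hM0 : 0 ≤ M := Finset.sum_nonneg fun i _ => le_min zero_le_one (by positivity)
    have hlogn : 1 ≤ 2 * Real.log n := by
      have h1 : Real.log 2 ≤ Real.log n := Real.log_le_log two_pos (by exact_mod_cast hn)
      have := Real.log_two_gt_d9
      linarith
    have h1 : Real.log k * M ≤ Real.log k * (k * (3 * Real.log n)) := by
      refine mul_le_mul_of_nonneg_left (hM'.trans ?_) hlogk
      gcongr
      linarith
    have h2 := mul_le_mul_of_nonneg_right hK hM0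
    nlinarith
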